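/- Consider the following five $6$-dimensional real nilpotent Lie algebras, each given by the nonzero brackets of a basis $e_1,\dots,e_6$ (up to antisymmetry): - $\mathfrak g_1$: $[e_1,e_2]=e_3$, $[e_1,e_3]=e_4$, $[e_1,e_4]=[e_2,e_3]=e_5$, $[e_3,e_4]=[e_5,e_2]=e_6$; - $\mathfrak g_2$: $[e_1,e_2]=e_3$, $[e_1,e_3]=e_4$, $[e_1,e_4]=e_5$, $[e_3,e_4]=[e_5,e_2]=e_6$; - $\mathfrak g_3$: $[e_1,e_2]=e_4$, $[e_1,e_3]=e_5$, $[e_1,e_4]=[e_3,e_5]=e_6$; - $\mathfrak g_4$: $[e_1,e_2]=e_4$, $[e_2,e_3]=e_5$, $[e_1,e_4]=[e_3,e_5]=e_6$; - $\mathfrak g_5$: $[e_1,e_2]=e_5$, $[e_1,e_5]=[e_3,e_4]=e_6$. For a smooth manifold $M$, let $b(u+\sigma,v+\tau)=\tau(u)+\sigma(v)$ be the canonical split form on $\mathbb TM=TM\oplus T^*M$. The Courant bracket of sections of $\mathbb TM$ is $$[u+\sigma,v+\tau]=[u,v]+\mathcal L_u\tau-\mathcal L_v\sigma-\tfrac12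 d(\tau(u)-\sigma(v)).$$ A generalized complex structure on $M$ is a smooth section $S$ of $\mathrm{End}(\mathbb TM)$ with $S^2=-\mathrm{id}$, skew-symmetric for $b$, such that the smooth sections of each of its $\pm i$-eigenbundles in $\mathbb TM\otimes\mathbb C$ are closed under the ($\mathbb C$-bilinearly extended) Courant bracket. For a pseudo-Riemannian metric $g$ on $M$, with $g^\flat(u)=g(u,\cdot)$, put $I_{-1}(u+\sigma)=-(g^\flat)^{-1}\sigma+g^\flat u$. An integrable $(-1,-1)$-structure on $(M,g)$ is a generalized complex structure $S$ with $SI_{-1}=-I_{-1}S$. **Theorem.** Let $G$ be a Lie group with Lie algebra isomorphic to one of $\mathfrak g_1,\dots,\mathfrak g_5$, and let $M=\Gamma\backslash G$ be the quotient by a discrete subgroup $\Gamma$ (for instance $M=G$ simply connected, or $M$ a compact nilmanifold). A tensor field on $M$ is called left invariant if it is induced by a left invariant one on $G$. Then $M$ admits neither a left invariant complex structure nor a left invariant symplectic structure, but $M$ admits a left invariant pseudo-Riemannian metric $g$ and a left invariant integrable $(-1,-1)$-structure on $(M,g)$. -/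

import Mathlib

open scoped Manifold ContDiff

noncomputable section

/-! ### The five nilpotent Lie algebras -/

namespace NilLie

/-- The alternating form `e^a ∧ e^b` on `ℝ⁶` in standard coordinates (indices start at `0`). -/
def wedge (a b : Fin 6) (x y : Fin 6 → ℝ) : ℝ := x a * y b - x b * y a

/-- The brackets of the five Lie algebras. In the notation where, e.g.,
`(0,0,12,13,14+23,34+52)` means `[e₁,e₂] = e₃`, `[e₁,e₃] = e₄`, `[e₁,e₄] = [e₂,e₃] = e₅`,
`[e₃,e₄] = [e₅,e₂] = e₆`, these are
`(0,0,12,13,14+23,34+52)`, `(0,0,12,13,14,34+52)`, `(0,0,0,12,13,14+35)`,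
`(0,0,0,12,23,14+35)`, `(0,0,0,0,12,15+34)`; the `k`-th entry is the `k`-th coordinate of
`[x,y]`, and the index `k` of the notation is `k - 1` below. -/
def nilBracket : Fin 5 → (Fin 6 → ℝ) → (Fin 6 → ℝ) → (Fin 6 → ℝ)
  | 0, x, y => ![0, 0, wedge 0 1 x y, wedge 0 2 x y, wedge 0 3 x y + wedge 1 2 x y,
      wedge 2 3 x y + wedge 4 1 x y]
  | 1, x, y => ![0, 0, wedge 0 1 x y, wedge 0 2 x y, wedge 0 3 x y,
      wedge 2 3 x y + wedge 4 1 x y]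
  | 2, x, y => ![0, 0, 0, wedge 0 1 x y, wedge 0 2 x y, wedge 0 3 x y + wedge 2 4 x y]
  | 3, x, y => ![0, 0, 0, wedge 0 1 x y, wedge 1 2 x y, wedge 0 3 x y + wedge 2 4 x y]
  | 4, x, y => ![0, 0, 0, 0, wedge 0 1 x y, wedge 0 4 x y + wedge 2 3 x y]

/-- The `i`-th Lie algebra: `ℝ⁶` with the bracket `nilBracket i`. -/
def NilAlg (_i : Fin 5) : Type := Fin 6 → ℝ

variable (i : Fin 5)

instance : AddCommGroup (NilAlg i) := inferInstanceAs (AddCommGroup (Fin 6 → ℝ))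

instance : Module ℝ (NilAlg i) := inferInstanceAs (Module ℝ (Fin 6 → ℝ))

instance : Bracket (NilAlg i) (NilAlg i) := ⟨nilBracket i⟩

theorem nilBracket_add_left (x y z : Fin 6 → ℝ) :
    nilBracket i (x + y) z = nilBracket i x z + nilBracket i y z := by
  funext k
  fin_cases i <;> fin_cases k <;> simp [nilBracket, wedge] <;> ring

theorem nilBracket_add_right (x y z : Fin 6 → ℝ) :
    nilBracket i x (y + z) = nilBracket i x y + nilBracket i x z := by
  funext k
  fin_cases i <;> fin_cases k <;> simp [nilBracket, wedge] <;> ring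

theorem nilBracket_self (x : Fin 6 → ℝ) : nilBracket i x x = 0 := by
  funext k
  fin_cases i <;> fin_cases k <;> simp [nilBracket, wedge] <;> ring

theorem nilBracket_jacobi (x y z : Fin 6 → ℝ) :
    nilBracket i x (nilBracket i y z) =
      nilBracket i (nilBracket i x y) z + nilBracket i y (nilBracket i x z) := by
  funext k
  fin_cases i <;> fin_cases k <;> simp [nilBracket, wedge] <;> ring

theorem nilBracket_smul (c : ℝ) (x y : Fin 6 → ℝ) :
    nilBracket i x (c • y) = c • nilBracket i x y := by
  funext k
  fin_cases i <;> fin_cases k <;> simp [nilBracket, wedge] <;> ring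

instance : LieRing (NilAlg i) where
  add_lie := nilBracket_add_left i
  lie_add := nilBracket_add_right i
  lie_self := nilBracket_self i
  leibniz_lie := nilBracket_jacobi i

instance : LieAlgebra ℝ (NilAlg i) where
  lie_smul := nilBracket_smul i

end NilLie

/-! ### Tensor fields on a smooth manifold -/

namespace GenGeom

/-- Makes the Lie algebra structure of `GroupLieAlgebra` available for `C^∞` Lie groups. -/
instance : ENat.LEInfty (minSmoothness ℝ 3) :=
  ⟨by rw [minSmoothness_of_isRCLikeNormedField]; exact ENat.LEInfty.out⟩

section Manifold

variable {n : ℕ} {M : Type*} [TopologicalSpace M] [ChartedSpace (EuclideanSpace ℝ (Fin n)) M]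

instance (x : M) : FiniteDimensional ℝ (TangentSpace (𝓡 n) x) :=
  inferInstanceAs (FiniteDimensional ℝ (EuclideanSpace ℝ (Fin n)))

variable (n M) in
/-- Vector fields (not necessarily smooth). -/
abbrev VField := ∀ x : M, TangentSpace (𝓡 n) x

variable (n M) in
/-- Fields of bilinear forms on the tangent spaces. -/
abbrev FormField := ∀ x : M, LinearMap.BilinForm ℝ (TangentSpace (𝓡 n) x)

variable (n M) in
/-- Fields of endomorphisms of the tangent spaces. -/
abbrev EndField := ∀ x : M, TangentSpace (𝓡 n) x →ₗ[ℝ] TangentSpace (𝓡 n) x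

variable (n) in
/-- The fibre `T_x M ⊕ T_x^* M` of the extended tangent bundle. -/
abbrev GenTangent (x : M) := TangentSpace (𝓡 n) x × Module.Dual ℝ (TangentSpace (𝓡 n) x)

variable (n M) in
/-- Sections `u + σ` of the extended tangent bundle (not necessarily smooth). -/
abbrev GenField := ∀ x : M, GenTangent n x

variable (n M) in
/-- Fields of endomorphisms of the extended tangent bundle. -/
abbrev GenEndField := ∀ x : M, GenTangent n x →ₗ[ℝ] GenTangent n x

variable [IsManifold (𝓡 n) ∞ M]

/-- Smooth vector fields. -/
def IsSmoothVField (u : VField n M) : Prop :=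
  ContMDiff (𝓡 n) (𝓡 n).tangent ∞ (fun x => (⟨x, u x⟩ : TangentBundle (𝓡 n) M))

/-- A section `u + σ` is smooth if `u` is a smooth vector field and `σ` a smooth 1-form, that is,
`σ(w)` is a smooth function for every smooth vector field `w`. -/
def IsSmoothGenField (s : GenField n M) : Prop :=
  IsSmoothVField (fun x => (s x).1) ∧
    ∀ w : VField n M, IsSmoothVField w →
      ContMDiff (𝓡 n) 𝓘(ℝ, ℝ) ∞ (fun x => (s x).2 (w x))

/-- A field of bilinear forms is smooth if it takes smooth vector fields to smooth functions. -/
def IsSmoothForm (β : FormField n M) : Prop :=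
  ∀ u v : VField n M, IsSmoothVField u → IsSmoothVField v →
    ContMDiff (𝓡 n) 𝓘(ℝ, ℝ) ∞ (fun x => β x (u x) (v x))

/-- A field of endomorphisms is smooth if it takes smooth vector fields to smooth vector fields. -/
def IsSmoothEnd (J : EndField n M) : Prop :=
  ∀ u : VField n M, IsSmoothVField u → IsSmoothVField (fun x => J x (u x))

/-- A field of endomorphisms of the extended tangent bundle is smooth if it takes smooth sections
to smooth sections. -/
def IsSmoothGenEnd (S : GenEndField n M) : Prop :=
  ∀ s : GenField n M, IsSmoothGenField s → IsSmoothGenField (fun x => S x (s x))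

/-- The derivative `u(f)` of a function along a vector field. -/
def dirDeriv (u : VField n M) (f : M → ℝ) (x : M) : ℝ :=
  mfderiv (𝓡 n) 𝓘(ℝ, ℝ) f x (u x)

/-- The Lie bracket of vector fields. -/
abbrev bracket (u v : VField n M) : VField n M := VectorField.mlieBracket (𝓡 n) u v

/-! ### Complex and symplectic structures -/

/-- A complex structure: a smooth almost complex structure with vanishing Nijenhuis tensor. -/
structure IsComplexStructure (J : EndField n M) : Prop where
  smooth : IsSmoothEnd J
  sq : ∀ x u, J x (J x u) = -u
  nijenhuis : ∀ u v : VField n M, IsSmoothVField u → IsSmoothVField v → ∀ x,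
    bracket (fun y => J y (u y)) (fun y => J y (v y)) x
      - J x (bracket (fun y => J y (u y)) v x) - J x (bracket u (fun y => J y (v y)) x)
      - bracket u v x = 0

/-- A symplectic structure: a smooth closed nondegenerate 2-form. -/
structure IsSymplectic (Ω : FormField n M) : Prop where
  smooth : IsSmoothForm Ω
  alt : ∀ x, (Ω x).IsAlt
  nondegenerate : ∀ x, (Ω x).Nondegenerate
  closed : ∀ u v w : VField n M, IsSmoothVField u → IsSmoothVField v → IsSmoothVField w → ∀ x,
    dirDeriv u (fun y => Ω y (v y) (w y)) x - dirDeriv v (fun y => Ω y (u y) (w y)) x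
      + dirDeriv w (fun y => Ω y (u y) (v y)) x
      - Ω x (bracket u v x) (w x) + Ω x (bracket u w x) (v x) - Ω x (bracket v w x) (u x) = 0

/-! ### Generalized complex structures -/

/-- The canonical split form `b(u + σ, v + τ) = τ(u) + σ(v)`. -/
def pairing {x : M} (s t : GenTangent n x) : ℝ := t.2 s.1 + s.2 t.1

/-- `(𝓛_u τ)(w) = u(τ(w)) - τ([u, w])`, for the 1-form part `τ` of a section. -/
def lieDerivForm (u : VField n M) (τ : ∀ x : M, Module.Dual ℝ (TangentSpace (𝓡 n) x))
    (w : VField n M) (x : M) : ℝ :=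
  dirDeriv u (fun y => τ y (w y)) x - τ x (bracket u w x)

/-- `r` is the Courant bracket
`[u + σ, v + τ] = [u, v] + 𝓛_u τ - 𝓛_v σ - ½ d(τ(u) - σ(v))` of `s = u + σ` and `t = v + τ`;
its 1-form part is described by its values on the smooth vector fields. -/
def IsCourantBracket (s t r : GenField n M) : Prop :=
  (∀ x, (r x).1 = bracket (fun y => (s y).1) (fun y => (t y).1) x) ∧
  ∀ w : VField n M, IsSmoothVField w → ∀ x,
    (r x).2 (w x) = lieDerivForm (fun y => (s y).1) (fun y => (t y).2) w x
      - lieDerivForm (fun y => (t y).1) (fun y => (s y).2) w x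
      - 1 / 2 * dirDeriv w (fun y => (t y).2 (s y).1 - (s y).2 (t y).1) x

variable (n M) in
/-- Sections `re + i im` of the complexified extended tangent bundle. -/
structure ComplexGenField where
  /-- the real part -/
  re : GenField n M
  /-- the imaginary part -/
  im : GenField n M

/-- `r` is the value of the `ℂ`-bilinear extension of the Courant bracket at `s` and `t`. -/
def IsComplexCourantBracket (s t r : ComplexGenField n M) : Prop :=
  ∃ p q p' q' : GenField n M,
    IsCourantBracket s.re t.re p ∧ IsCourantBracket s.im t.im q ∧
    IsCourantBracket s.re t.im p' ∧ IsCourantBracket s.im t.re q' ∧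
    (∀ x, r.re x = p x - q x) ∧ ∀ x, r.im x = p' x + q' x

/-- `s` is a smooth section of the `ε i`-eigenbundle of (the `ℂ`-linear extension of) `S`, that is,
`S (re + i im) = ε i (re + i im)`. -/
def IsEigenSection (S : GenEndField n M) (ε : ℝ) (s : ComplexGenField n M) : Prop :=
  IsSmoothGenField s.re ∧ IsSmoothGenField s.im ∧
    ∀ x, S x (s.re x) = -(ε • s.im x) ∧ S x (s.im x) = ε • s.re x

/-- Generalized complex structures: `S² = -id`, `S` is skew-symmetric for the canonical form, and
the smooth sections of each of the `±i`-eigenbundles are closed under the Courant bracket.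
(`S` is automatically split, i.e. traceless, since `S² = -id`.) -/
structure IsGeneralizedComplex (S : GenEndField n M) : Prop where
  smooth : IsSmoothGenEnd S
  sq : ∀ x s, S x (S x s) = -s
  skew : ∀ x s t, pairing (S x s) t = -pairing s (S x t)
  involutive : ∀ ε : ℝ, ε = 1 ∨ ε = -1 → ∀ s t : ComplexGenField n M,
    IsEigenSection S ε s → IsEigenSection S ε t →
      ∃ r : ComplexGenField n M, IsComplexCourantBracket s t r ∧ IsEigenSection S ε r

/-! ### Pseudo-Riemannian metrics and `(-1,-1)`-structures -/

/-- Pseudo-Riemannian metrics: smooth fields of nondegenerate symmetric bilinear forms. -/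
structure IsPseudoRiemannian (g : FormField n M) : Prop where
  smooth : IsSmoothForm g
  symm : ∀ x u v, g x u v = g x v u
  nondegenerate : ∀ x, (g x).Nondegenerate

/-- `I_k (u + σ) = k (g^♭)⁻¹ σ + g^♭ u`. -/
def metricEnd {g : FormField n M} (hg : IsPseudoRiemannian g) (k : ℝ) : GenEndField n M :=
  fun x => LinearMap.prod
    (k • ((g x).toDual (hg.nondegenerate x)).symm.toLinearMap ∘ₗ LinearMap.snd ℝ _ _)
    (((g x).toDual (hg.nondegenerate x)).toLinearMap ∘ₗ LinearMap.fst ℝ _ _)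

/-- Integrable `(-1, ℓ)`-structures on a pseudo-Riemannian manifold `(M, g)` (`ℓ = ±1`):
generalized complex structures `S` with `S I_k = - I_k S`, where `k = -λ ℓ` and `λ = -1`. -/
def IsIntegrableNegStructure {g : FormField n M} (hg : IsPseudoRiemannian g) (ℓ : ℝ)
    (S : GenEndField n M) : Prop :=
  IsGeneralizedComplex S ∧
    ∀ x s, S x (metricEnd hg (-(-1) * ℓ) x s) = -metricEnd hg (-(-1) * ℓ) x (S x s)

end Manifold

/-! ### Invariance -/

section Related

variable {n : ℕ} {M : Type*} [TopologicalSpace M] [ChartedSpace (EuclideanSpace ℝ (Fin n)) M]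
  {N : Type*} [TopologicalSpace N] [ChartedSpace (EuclideanSpace ℝ (Fin n)) N]

/-- `β'` is the pullback of `β` by `f`. -/
def FormRelated (f : N → M) (β' : FormField n N) (β : FormField n M) : Prop :=
  ∀ x u v, β' x u v = β (f x) (mfderiv (𝓡 n) (𝓡 n) f x u) (mfderiv (𝓡 n) (𝓡 n) f x v)

/-- `J'` and `J` correspond to each other under the differential of `f`. -/
def EndRelated (f : N → M) (J' : EndField n N) (J : EndField n M) : Prop :=
  ∀ x u, mfderiv (𝓡 n) (𝓡 n) f x (J' x u) = J (f x) (mfderiv (𝓡 n) (𝓡 n) f x u)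

/-- `s = u' + σ'` at `x` and `t = u + σ` at `f x` are `f`-related: `df u' = u`, `f^* σ = σ'`.
For a local diffeomorphism `f` this is the graph of a linear isomorphism. -/
def GenRelated (f : N → M) (x : N) (s : GenTangent n x) (t : GenTangent n (f x)) : Prop :=
  mfderiv (𝓡 n) (𝓡 n) f x s.1 = t.1 ∧ ∀ v, s.2 v = t.2 (mfderiv (𝓡 n) (𝓡 n) f x v)

/-- `S'` and `S` correspond to each other under `f`. -/
def GenEndRelated (f : N → M) (S' : GenEndField n N) (S : GenEndField n M) : Prop :=
  ∀ x s t, GenRelated f x s t → GenRelated f x (S' x s) (S (f x) t)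

end Related

section Quotient

variable {n : ℕ} {M : Type*} [TopologicalSpace M] [ChartedSpace (EuclideanSpace ℝ (Fin n)) M]
  {G : Type*} [TopologicalSpace G] [ChartedSpace (EuclideanSpace ℝ (Fin n)) G] [Group G]

variable (n) in
/-- `π : G → M` exhibits the manifold `M` as the quotient `Γ \ G`. -/
structure IsLeftQuotient (Γ : Subgroup G) (π : G → M) : Prop where
  surjective : Function.Surjective π
  localDiffeo : IsLocalDiffeomorph (𝓡 n) (𝓡 n) ∞ π
  fiber : ∀ x y, π x = π y ↔ ∃ γ ∈ Γ, γ * x = y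

/-- A field of bilinear forms on `Γ \ G` is left invariant if it is induced by a field on `G` that
is invariant under all left translations. For `Γ` trivial and `π = id`, this is left invariance on
`G`; similarly for the next two notions. -/
def IsLeftInvariantForm (π : G → M) (β : FormField n M) : Prop :=
  ∃ β' : FormField n G, (∀ h : G, FormRelated (fun x => h * x) β' β') ∧ FormRelated π β' β

/-- Left invariant fields of endomorphisms on `Γ \ G`. -/
def IsLeftInvariantEnd (π : G → M) (J : EndField n M) : Prop :=
  ∃ J' : EndField n G, (∀ h : G, EndRelated (fun x => h * x) J' J') ∧ EndRelated π J' J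

/-- Left invariant fields of endomorphisms of the extended tangent bundle on `Γ \ G`. -/
def IsLeftInvariantGenEnd (π : G → M) (S : GenEndField n M) : Prop :=
  ∃ S' : GenEndField n G, (∀ h : G, GenEndRelated (fun x => h * x) S' S') ∧ GenEndRelated π S' S

end Quotient

end GenGeom

end

noncomputable section

/-! ### Linear algebra of the five Lie algebras -/

namespace NilLie

/-! Everything reduces to linear algebra on the Lie algebra. The left invariant vector fields form a
global frame of `G` with constant structure functions. It descends to `M` because `π ∘ L_γ = π` for
`γ ∈ Γ`. Left invariant tensors have constant coefficients in this frame (`exists_endCoeff`,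
`exists_formCoeff`), and constant coefficients give left invariant tensors
(`FrameRelated.formRelated`, `FrameRelated.genEndRelated`). Below, `e₀, …, e₅` are numbered from
zero.

Complex structures (`not_complex`). The vector `e₅` is central; put `v = J e₅`. The Nijenhuis
condition at `(e₅, y)` says that `ad v` commutes with `J`. If `[v, y] = c e₅`, then `[v, J y] = c
v`, and comparing coordinates kills those of `v` one after the other. Where this stops, `ad v` or
its cube has rank at most one and a `J`-stable image, which must vanish since `J` has no real
eigenvectors. In the end `v` is a multiple of `e₅`, again a real eigenvector. Only for `i = 3` can
`ad v` have rank two; there `J` would be skew for an indefinite form on a plane.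

Symplectic structures (`closed_form_stdVec_five`). Closedness forces `e₅` into the kernel of the
form.

Existence. Explicit `genStruct` and `metric` satisfy the algebraic identities. The block `T* → T` of
`genStruct` has rank four for `i < 4` and rank two for `i = 4`. Since integrability concerns all
smooth sections, the Courant bracket is written in coefficients as an algebraic bracket, derivatives
of coefficients and a correction made of pairings. The eigenbundles are constant in the frame, so
derivatives stay inside them; they are isotropic, so the correction cancels; the algebraic term is
controlled by `genStruct_nijenhuis`. This is `isEigenPair_courantCoeff`. -/

/-- The standard basis of `ℝ⁶`. -/
abbrev stdVec (k : Fin 6) : Fin 6 → ℝ := Pi.single k 1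

theorem map_eq_sum_single {n : ℕ} {E : Type*} [AddCommGroup E] [Module ℝ E]
    (f : (Fin n → ℝ) →ₗ[ℝ] E) (v : Fin n → ℝ) : f v = ∑ k, v k • f (Pi.single k 1) := by
  conv_lhs => rw [pi_eq_sum_univ' v]
  simp [map_sum, map_smul]

theorem nilBracket_apply_stdVec_five (i : Fin 5) (y : Fin 6 → ℝ) :
    nilBracket i (stdVec 5) y = 0 := by
  funext k
  fin_cases i <;> fin_cases k <;> simp [nilBracket, wedge]

/-! #### Complex structures -/

section Complex

variable {i : Fin 5} {J : (Fin 6 → ℝ) →ₗ[ℝ] (Fin 6 → ℝ)}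

/-- A real eigenvalue would satisfy `c² = -1`. -/
theorem eq_zero_of_eigenvector (hJ : ∀ u, J (J u) = -u) {w : Fin 6 → ℝ} {c : ℝ}
    (hw : J w = c • w) : w = 0 := by
  have h := hJ w
  rw [hw, map_smul, hw] at h
  funext k
  have hk := congrFun h k
  simp only [Pi.smul_apply, smul_eq_mul, Pi.neg_apply] at hk
  have : (c * c + 1) * w k = 0 := by linarith
  rcases mul_eq_zero.1 this with h0 | h0
  · nlinarith [mul_self_nonneg c]
  · simpa using h0

/-- The image under `J` of a central element acts complex linearly. -/
theorem bracket_comm_of_nijenhuis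
    (hN : ∀ u v, nilBracket i (J u) (J v) - J (nilBracket i (J u) v) - J (nilBracket i u (J v))
      - nilBracket i u v = 0) (y : Fin 6 → ℝ) :
    nilBracket i (J (stdVec 5)) (J y) = J (nilBracket i (J (stdVec 5)) y) := by
  have h := hN (stdVec 5) y
  simpa [nilBracket_apply_stdVec_five, sub_eq_zero] using h

/-- The device that kills a coordinate of `v = J e₅`: take `y` with `[v, y] = ± v k • e₅`, where all
brackets with `v` already have zero `k`-th coordinate. The identity then reads `0 = ± (v k)²`. -/
theorem bracket_apply_of_eq_smul (hA : ∀ y, nilBracket i (J (stdVec 5)) (J y) =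
      J (nilBracket i (J (stdVec 5)) y)) {y : Fin 6 → ℝ} {c : ℝ}
    (hy : nilBracket i (J (stdVec 5)) y = c • stdVec 5) (k : Fin 6) :
    nilBracket i (J (stdVec 5)) (J y) k = c * J (stdVec 5) k := by
  rw [hA, hy, map_smul, Pi.smul_apply, smul_eq_mul]

theorem false_of_forall_lt_five (hJ : ∀ u, J (J u) = -u)
    (h0 : J (stdVec 5) 0 = 0) (h1 : J (stdVec 5) 1 = 0) (h2 : J (stdVec 5) 2 = 0)
    (h3 : J (stdVec 5) 3 = 0) (h4 : J (stdVec 5) 4 = 0) : False := by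
  have h : J (stdVec 5) = (J (stdVec 5) 5) • stdVec 5 := by
    funext k
    fin_cases k <;> simp [h0, h1, h2, h3, h4]
  have := congrFun (eq_zero_of_eigenvector hJ h) 5
  simp at this

theorem not_complex_zero (hJ : ∀ u, J (J u) = -u)
    (hA : ∀ y, nilBracket 0 (J (stdVec 5)) (J y) = J (nilBracket 0 (J (stdVec 5)) y)) : False := by
  set v := J (stdVec 5) with hv
  have h1 : v 1 = 0 := by
    have h := bracket_apply_of_eq_smul hA (y := stdVec 4) (c := -v 1)
      (by rw [← hv]; funext k; fin_cases k <;> simp [nilBracket, wedge]) 1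
    simpa [nilBracket, ← hv] using h
  -- A single bracket with `e₃` is not enough here: `[v, e₃] = v₀ e₄ + v₂ e₅` is not a multiple of
  -- `e₅`. Instead, `(ad v)³` has rank at most one and commutes with `J`.
  have h0 : v 0 = 0 := by
    have hA3 (y : Fin 6 → ℝ) :
        nilBracket 0 v (nilBracket 0 v (nilBracket 0 v y)) =
          y 1 • ![0, 0, 0, 0, v 0 ^ 3, v 0 ^ 2 * v 2] := by
      funext k
      fin_cases k <;> simp [nilBracket, wedge, h1] <;> ring
    -- Here `w = (ad v)³ e₁`, so `J w = (ad v)³ (J e₁)`, which is the `e₁`-coordinate of `J e₁`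
    -- times `w`.
    have h := eq_zero_of_eigenvector hJ (w := ![0, 0, 0, 0, v 0 ^ 3, v 0 ^ 2 * v 2])
      (c := J (stdVec 1) 1) (by
        rw [← hA3 (J (stdVec 1)), hA, hA, hA, hA3]
        simp)
    have := congrFun h 4
    simpa using this
  have h2 : v 2 = 0 := by
    have h := bracket_apply_of_eq_smul hA (y := stdVec 3) (c := v 2)
      (by rw [← hv]; funext k; fin_cases k <;> simp [nilBracket, wedge, h0]) 2
    simpa [nilBracket, wedge, ← hv, h0, h1] using h
  have h3 : v 3 = 0 := by
    have h := bracket_apply_of_eq_smul hA (y := stdVec 2) (c := -v 3)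
      (by rw [← hv]; funext k; fin_cases k <;> simp [nilBracket, wedge, h0, h1]) 3
    simpa [nilBracket, wedge, ← hv, h0, h2] using h
  have h4 : v 4 = 0 := by
    have h := bracket_apply_of_eq_smul hA (y := stdVec 1) (c := v 4)
      (by rw [← hv]; funext k; fin_cases k <;> simp [nilBracket, wedge, h0, h2]) 4
    simpa [nilBracket, wedge, ← hv, h0, h1, h2, h3] using h
  exact false_of_forall_lt_five hJ h0 h1 h2 h3 h4

/-- This algebra differs from the previous one only by the missing `wedge 1 2`; the elimination runs
in the same order. -/
theorem not_complex_one (hJ : ∀ u, J (J u) = -u)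
    (hA : ∀ y, nilBracket 1 (J (stdVec 5)) (J y) = J (nilBracket 1 (J (stdVec 5)) y)) : False := by
  set v := J (stdVec 5) with hv
  have h1 : v 1 = 0 := by
    have h := bracket_apply_of_eq_smul hA (y := stdVec 4) (c := -v 1)
      (by rw [← hv]; funext k; fin_cases k <;> simp [nilBracket, wedge]) 1
    simpa [nilBracket, ← hv] using h
  have h0 : v 0 = 0 := by
    have hA3 (y : Fin 6 → ℝ) :
        nilBracket 1 v (nilBracket 1 v (nilBracket 1 v y)) =
          y 1 • ![0, 0, 0, 0, v 0 ^ 3, v 0 ^ 2 * v 2] := by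
      funext k
      fin_cases k <;> simp [nilBracket, wedge, h1] <;> ring
    have h := eq_zero_of_eigenvector hJ (w := ![0, 0, 0, 0, v 0 ^ 3, v 0 ^ 2 * v 2])
      (c := J (stdVec 1) 1) (by
        rw [← hA3 (J (stdVec 1)), hA, hA, hA, hA3]
        simp)
    have := congrFun h 4
    simpa using this
  have h2 : v 2 = 0 := by
    have h := bracket_apply_of_eq_smul hA (y := stdVec 3) (c := v 2)
      (by rw [← hv]; funext k; fin_cases k <;> simp [nilBracket, wedge, h0]) 2
    simpa [nilBracket, wedge, ← hv, h0, h1] using h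
  have h3 : v 3 = 0 := by
    have h := bracket_apply_of_eq_smul hA (y := stdVec 2) (c := -v 3)
      (by rw [← hv]; funext k; fin_cases k <;> simp [nilBracket, wedge, h0]) 3
    simpa [nilBracket, wedge, ← hv, h0, h2] using h
  have h4 : v 4 = 0 := by
    have h := bracket_apply_of_eq_smul hA (y := stdVec 1) (c := v 4)
      (by rw [← hv]; funext k; fin_cases k <;> simp [nilBracket, wedge, h0]) 4
    simpa [nilBracket, wedge, ← hv, h0, h3] using h
  exact false_of_forall_lt_five hJ h0 h1 h2 h3 h4

theorem not_complex_two (hJ : ∀ u, J (J u) = -u)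
    (hA : ∀ y, nilBracket 2 (J (stdVec 5)) (J y) = J (nilBracket 2 (J (stdVec 5)) y)) : False := by
  set v := J (stdVec 5) with hv
  have h0 : v 0 = 0 := by
    have h := bracket_apply_of_eq_smul hA (y := stdVec 3) (c := v 0)
      (by rw [← hv]; funext k; fin_cases k <;> simp [nilBracket, wedge]) 0
    simpa [nilBracket, ← hv] using h
  have h2 : v 2 = 0 := by
    have h := bracket_apply_of_eq_smul hA (y := stdVec 4) (c := v 2)
      (by rw [← hv]; funext k; fin_cases k <;> simp [nilBracket, wedge]) 2
    simpa [nilBracket, ← hv] using h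
  have h4 : v 4 = 0 := by
    have h := bracket_apply_of_eq_smul hA (y := stdVec 2) (c := -v 4)
      (by rw [← hv]; funext k; fin_cases k <;> simp [nilBracket, wedge, h0]) 4
    simpa [nilBracket, wedge, ← hv, h0, h2] using h
  -- Now `ad v` itself has rank at most one, so its generator is a real eigenvector of `J`; this
  -- removes both remaining coordinates at once.
  have hA1 (y : Fin 6 → ℝ) : nilBracket 2 v y = y 0 • ![0, 0, 0, -v 1, 0, -v 3] := by
    funext k
    fin_cases k <;> simp [nilBracket, wedge, h0, h2, h4] <;> ring
  have h := eq_zero_of_eigenvector hJ (w := ![0, 0, 0, -v 1, 0, -v 3]) (c := J (stdVec 0) 0) (by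
    rw [← hA1 (J (stdVec 0)), hA, hA1]
    simp)
  have h1 := congrFun h 3
  have h3 := congrFun h 5
  simp at h1 h3
  exact false_of_forall_lt_five hJ h0 h1 h2 h3 h4

/-- When `v 1 ≠ 0`, the image of `ad v` is a plane and commutation with `J` gives no contradiction,
so the full Nijenhuis condition is needed. The `e₅`-coefficient of `[[v, x], y]` is `v₁ (x₀ y₀ - x₂
y₂)`. The map `J` turns out to be skew for this indefinite form; on a plane such a map has
nonnegative square, against `J² = -1`. -/
theorem not_complex_three (hJ : ∀ u, J (J u) = -u)
    (hN : ∀ u v, nilBracket 3 (J u) (J v) - J (nilBracket 3 (J u) v) - J (nilBracket 3 u (J v))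
      - nilBracket 3 u v = 0) : False := by
  have hA := bracket_comm_of_nijenhuis hN
  set v := J (stdVec 5) with hv
  have h0 : v 0 = 0 := by
    have h := bracket_apply_of_eq_smul hA (y := stdVec 3) (c := v 0)
      (by rw [← hv]; funext k; fin_cases k <;> simp [nilBracket, wedge]) 0
    simpa [nilBracket, ← hv] using h
  have h2 : v 2 = 0 := by
    have h := bracket_apply_of_eq_smul hA (y := stdVec 4) (c := v 2)
      (by rw [← hv]; funext k; fin_cases k <;> simp [nilBracket, wedge]) 2
    simpa [nilBracket, ← hv] using h
  have hA1 (y : Fin 6 → ℝ) : nilBracket 3 v y =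
      ![0, 0, 0, -v 1 * y 0, v 1 * y 2, -v 3 * y 0 - v 4 * y 2] := by
    funext k
    fin_cases k <;> simp [nilBracket, wedge, h0, h2]
    ring
  by_cases h1 : v 1 = 0
  · have h3 : v 3 = 0 := by
      have h := bracket_apply_of_eq_smul hA (y := stdVec 0) (c := -v 3)
        (by rw [← hv, hA1]; funext k; fin_cases k <;> simp [h1]) 3
      rw [← hv, hA1] at h
      simpa [h1] using h
    have h4 : v 4 = 0 := by
      have h := bracket_apply_of_eq_smul hA (y := stdVec 2) (c := -v 4)
        (by rw [← hv, hA1]; funext k; fin_cases k <;> simp [h1]) 4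
      rw [← hv, hA1] at h
      simpa [h1] using h
    exact false_of_forall_lt_five hJ h0 h1 h2 h3 h4
  /- The brackets of elements `w` of `⟨e₃, e₄, e₅⟩` are multiples of `e₅`, while
  `J e₅` is not. -/
  have hB (w y : Fin 6 → ℝ) (w0 : w 0 = 0) (w1 : w 1 = 0) (w2 : w 2 = 0) :
      nilBracket 3 w y = (-w 3 * y 0 - w 4 * y 2) • stdVec 5 := by
    funext k
    fin_cases k <;> simp [nilBracket, wedge, w0, w1, w2]
    ring
  -- Skewness of `J`: take the Nijenhuis condition at `([v, x], y)` in coordinate 1. The brackets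
  -- are multiples of `e₅` and drop out there, while their images under `J` are multiples of `v` and
  -- contribute `v 1`.
  have hC (x y : Fin 6 → ℝ) :
      (J (nilBracket 3 v x) 3 * y 0 + J (nilBracket 3 v x) 4 * y 2)
        + (nilBracket 3 v x 3 * J y 0 + nilBracket 3 v x 4 * J y 2) = 0 := by
    have h := congrFun (hN (nilBracket 3 v x) y) 1
    rw [← hA, hB (nilBracket 3 v (J x)), hB (nilBracket 3 v (J x)), hB (nilBracket 3 v x),
      hB (nilBracket 3 v x), map_smul, map_smul, ← hv] at h
    · simp at h
      rw [← hA]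
      have : ((nilBracket 3 v (J x) 3 * y 0 + nilBracket 3 v (J x) 4 * y 2)
        + (nilBracket 3 v x 3 * J y 0 + nilBracket 3 v x 4 * J y 2)) * v 1 = 0 := by
        linarith
      exact (mul_eq_zero.1 this).resolve_right h1
    all_goals simp [nilBracket]
  have h00 := hC (stdVec 0) (stdVec 0)
  have h02 := hC (stdVec 0) (stdVec 2)
  -- The image of `ad v` is `J`-stable, and only the coordinates 0 and 2 of `J x` enter, so `J` acts
  -- by a `2 × 2` matrix.
  have hJA (x : Fin 6 → ℝ) : J (nilBracket 3 v x) =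
      J x 0 • nilBracket 3 v (stdVec 0) + J x 2 • nilBracket 3 v (stdVec 2) := by
    rw [← hA, hA1, hA1, hA1]
    funext k
    fin_cases k <;> simp <;> ring
  have hsq := congrFun (hJ (nilBracket 3 v (stdVec 0))) 3
  rw [hJA, map_add, map_smul, map_smul, hJA, hJA, hA1, hA1] at hsq
  rw [← hA, hA1, hA1] at h00 h02
  simp at h00 h02 hsq
  -- Skewness makes the first diagonal entry zero and the off-diagonal entries equal, say to `b`;
  -- then `J² = -1` gives `b² = -1`.
  have ha : J (stdVec 0) 0 = 0 := h00.resolve_left h1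
  have hb : J (stdVec 0) 2 = J (stdVec 2) 0 := mul_left_cancel₀ h1 (by linarith)
  have : (J (stdVec 0) 2 * J (stdVec 0) 2 + 1) * v 1 = 0 := by
    rw [ha, ← hb] at hsq
    linarith
  rcases mul_eq_zero.1 this with h | h
  · nlinarith [mul_self_nonneg (J (stdVec 0) 2)]
  · exact h1 h

theorem not_complex_four (hJ : ∀ u, J (J u) = -u)
    (hA : ∀ y, nilBracket 4 (J (stdVec 5)) (J y) = J (nilBracket 4 (J (stdVec 5)) y)) : False := by
  set v := J (stdVec 5) with hv
  have h0 : v 0 = 0 := by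
    have h := bracket_apply_of_eq_smul hA (y := stdVec 4) (c := v 0)
      (by rw [← hv]; funext k; fin_cases k <;> simp [nilBracket, wedge]) 0
    simpa [nilBracket, ← hv] using h
  have h2 : v 2 = 0 := by
    have h := bracket_apply_of_eq_smul hA (y := stdVec 3) (c := v 2)
      (by rw [← hv]; funext k; fin_cases k <;> simp [nilBracket, wedge]) 2
    simpa [nilBracket, ← hv] using h
  have h3 : v 3 = 0 := by
    have h := bracket_apply_of_eq_smul hA (y := stdVec 2) (c := -v 3)
      (by rw [← hv]; funext k; fin_cases k <;> simp [nilBracket, wedge]) 3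
    simpa [nilBracket, ← hv] using h
  have hA1 (y : Fin 6 → ℝ) : nilBracket 4 v y = y 0 • ![0, 0, 0, 0, -v 1, -v 4] := by
    funext k
    fin_cases k <;> simp [nilBracket, wedge, h0, h2, h3] <;> ring
  have h := eq_zero_of_eigenvector hJ (w := ![0, 0, 0, 0, -v 1, -v 4]) (c := J (stdVec 0) 0) (by
    rw [← hA1 (J (stdVec 0)), hA, hA1]
    simp)
  have h1 := congrFun h 4
  have h4 := congrFun h 5
  simp at h1 h4
  exact false_of_forall_lt_five hJ h0 h1 h2 h3 h4

/-- None of the five Lie algebras has a complex structure. -/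
theorem not_complex (i : Fin 5) (hJ : ∀ u, J (J u) = -u)
    (hN : ∀ u v, nilBracket i (J u) (J v) - J (nilBracket i (J u) v) - J (nilBracket i u (J v))
      - nilBracket i u v = 0) : False := by
  have hA := bracket_comm_of_nijenhuis hN
  fin_cases i
  · exact not_complex_zero hJ hA
  · exact not_complex_one hJ hA
  · exact not_complex_two hJ hA
  · exact not_complex_three hJ hN
  · exact not_complex_four hJ hA

end Complex

/-! #### Closed 2-forms -/

/-- The vector `e₅` lies in the kernel of every closed 2-form. -/
theorem closed_form_stdVec_five (i : Fin 5) (Ω : LinearMap.BilinForm ℝ (Fin 6 → ℝ))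
    (halt : Ω.IsAlt)
    (hcl : ∀ u v w, Ω (nilBracket i u v) w - Ω (nilBracket i u w) v + Ω (nilBracket i v w) u = 0) :
    Ω (stdVec 5) = 0 := by
  have hexp (x y : Fin 6 → ℝ) : Ω x y = ∑ k, x k * Ω (stdVec k) y := by
    rw [map_eq_sum_single Ω x]
    simp
  have hs (a b : Fin 6) : Ω (stdVec a) (stdVec b) = -Ω (stdVec b) (stdVec a) :=
    (halt.neg_eq _ _).symm
  have h0 (a : Fin 6) : Ω (stdVec a) (stdVec a) = 0 := halt _
  -- Most triples used below start with a pair whose bracket is `e₅`. For `i = 0, 1`, the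
  -- presentations `e₅ = [e₂, e₃] = [e₄, e₁]` give `Ω(e₅, e₀) = Ω(e₄, e₂)` and `Ω(e₅, e₀) = Ω(e₂,
  -- e₄)`, hence zero. The triples `(0, 2, 4)` for `i = 0, 1` and `(0, 1, 4)` for `i = 2` supply
  -- `Ω(e₃, e₄) = 0`.
  have key (a b c : Fin 6) := hcl (stdVec a) (stdVec b) (stdVec c)
  simp only [hexp (nilBracket i _ _)] at key
  have h5 (k : Fin 6) : Ω (stdVec 5) (stdVec k) = 0 := by
    have hs34 := hs 3 4
    have hs24 := hs 2 4
    fin_cases i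
    · have k230 := key 2 3 0
      have k231 := key 2 3 1
      have k234 := key 2 3 4
      have k410 := key 4 1 0
      have k412 := key 4 1 2
      have k413 := key 4 1 3
      have k024 := key 0 2 4
      simp [Fin.sum_univ_six, nilBracket, wedge] at k230 k231 k234 k410 k412 k413 k024
      fin_cases k <;> simp <;> linarith [hs34, hs24, h0 3, h0 4, h0 5]
    · have k230 := key 2 3 0
      have k231 := key 2 3 1
      have k234 := key 2 3 4
      have k410 := key 4 1 0
      have k412 := key 4 1 2
      have k413 := key 4 1 3
      have k024 := key 0 2 4
      simp [Fin.sum_univ_six, nilBracket, wedge] at k230 k231 k234 k410 k412 k413 k024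
      fin_cases k <;> simp <;> linarith [hs34, hs24, h0 3, h0 4, h0 5]
    · have k031 := key 0 3 1
      have k032 := key 0 3 2
      have k034 := key 0 3 4
      have k240 := key 2 4 0
      have k243 := key 2 4 3
      have k014 := key 0 1 4
      simp [Fin.sum_univ_six, nilBracket, wedge] at k031 k032 k034 k240 k243 k014
      fin_cases k <;> simp <;> linarith [hs34, hs24, h0 3, h0 4, h0 5]
    · have k031 := key 0 3 1
      have k032 := key 0 3 2
      have k034 := key 0 3 4
      have k240 := key 2 4 0
      have k243 := key 2 4 3
      simp [Fin.sum_univ_six, nilBracket, wedge] at k031 k032 k034 k240 k243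
      fin_cases k <;> simp <;> linarith [hs34, hs24, h0 3, h0 4, h0 5]
    · have k041 := key 0 4 1
      have k042 := key 0 4 2
      have k043 := key 0 4 3
      have k230 := key 2 3 0
      have k234 := key 2 3 4
      simp [Fin.sum_univ_six, nilBracket, wedge] at k041 k042 k043 k230 k234
      fin_cases k <;> simp <;> linarith [hs34, hs24, h0 3, h0 4, h0 5]
  apply LinearMap.pi_ext'
  intro k
  ext
  simpa using h5 k

end NilLie

end

noncomputable section

/-! ### Generalized complex structures on the five Lie algebras -/

namespace NilLie

open Matrix

/-- The canonical split form on `ℝⁿ ⊕ (ℝⁿ)^*`. -/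
def dualPairing {n : ℕ} (a b : (Fin n → ℝ) × (Fin n → ℝ)) : ℝ := b.2 ⬝ᵥ a.1 + a.2 ⬝ᵥ b.1

/-- The Courant bracket of constant sections: the bracket of the semidirect product with the
coadjoint representation. -/
def courantAlg {n : ℕ} (B : (Fin n → ℝ) → (Fin n → ℝ) → (Fin n → ℝ))
    (a b : (Fin n → ℝ) × (Fin n → ℝ)) : (Fin n → ℝ) × (Fin n → ℝ) :=
  (B a.1 b.1, fun k => a.2 ⬝ᵥ B b.1 (Pi.single k 1) - b.2 ⬝ᵥ B a.1 (Pi.single k 1))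

/-- The values of the generalized complex structures. -/
def genFun : Fin 5 → (Fin 6 → ℝ) → (Fin 6 → ℝ) → (Fin 6 → ℝ) × (Fin 6 → ℝ)
  | 0, u, σ =>
    (![-u 1, u 0, u 2 - σ 5, -u 3 - σ 4 - σ 5, -u 4 + σ 3, -2 * u 4 + u 5 + σ 2 + σ 3],
      ![-σ 1, σ 0, 2 * u 4 - 2 * u 5 - σ 2, -2 * u 4 + σ 3,
        -2 * u 2 + 2 * u 3 + σ 4 + 2 * σ 5, 2 * u 2 - σ 5])
  | 1, u, σ =>
    (![-u 1, u 0, u 2 - σ 5, -u 3 - σ 4, -u 4 + σ 3, u 5 + σ 2],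
      ![-σ 1, σ 0, -2 * u 5 - σ 2, -2 * u 4 + σ 3, 2 * u 3 + σ 4, 2 * u 2 - σ 5])
  | 2, u, σ => (![-u 1, u 0, -σ 5, -σ 4, σ 3, σ 2], ![-σ 1, σ 0, -u 5, -u 4, u 3, u 2])
  | 3, u, σ =>
    (![-u 1, u 0, u 2 - σ 5, -u 3 + σ 4, -u 4 - σ 3, u 5 + σ 2],
      ![-σ 1, σ 0, -2 * u 5 - σ 2, 2 * u 4 + σ 3, -2 * u 3 + σ 4, 2 * u 2 - σ 5])
  | 4, u, σ => (![-u 1, u 0, -u 3, u 2, -σ 5, σ 4], ![-σ 1, σ 0, -σ 3, σ 2, -u 5, u 4])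

/-- A generalized complex structure on each of the five Lie algebras. -/
def genStruct (i : Fin 5) :
    (Fin 6 → ℝ) × (Fin 6 → ℝ) →ₗ[ℝ] (Fin 6 → ℝ) × (Fin 6 → ℝ) where
  toFun a := genFun i a.1 a.2
  map_add' a b := by
    ext k <;> fin_cases i <;> fin_cases k <;> simp [genFun] <;> ring
  map_smul' c a := by
    ext k <;> fin_cases i <;> fin_cases k <;> simp [genFun] <;> ring

theorem genStruct_sq (i : Fin 5) (a : (Fin 6 → ℝ) × (Fin 6 → ℝ)) :
    genStruct i (genStruct i a) = -a := by
  ext k <;> fin_cases i <;> fin_cases k <;> simp [genStruct, genFun] <;> ring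

theorem genStruct_skew (i : Fin 5) (a b : (Fin 6 → ℝ) × (Fin 6 → ℝ)) :
    dualPairing (genStruct i a) b = -dualPairing a (genStruct i b) := by
  fin_cases i <;> simp [genStruct, genFun, dualPairing, dotProduct, Fin.sum_univ_six] <;> ring

/-- The transposes of the adjoint maps: `coadFun i u τ = τ([u, ·])`. -/
def coadFun : Fin 5 → (Fin 6 → ℝ) → (Fin 6 → ℝ) → (Fin 6 → ℝ)
  | 0, u, τ => ![-u 1 * τ 2 - u 2 * τ 3 - u 3 * τ 4, u 0 * τ 2 - u 2 * τ 4 + u 4 * τ 5,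
      u 0 * τ 3 + u 1 * τ 4 - u 3 * τ 5, u 0 * τ 4 + u 2 * τ 5, -u 1 * τ 5, 0]
  | 1, u, τ => ![-u 1 * τ 2 - u 2 * τ 3 - u 3 * τ 4, u 0 * τ 2 + u 4 * τ 5,
      u 0 * τ 3 - u 3 * τ 5, u 0 * τ 4 + u 2 * τ 5, -u 1 * τ 5, 0]
  | 2, u, τ => ![-u 1 * τ 3 - u 2 * τ 4 - u 3 * τ 5, u 0 * τ 3, u 0 * τ 4 - u 4 * τ 5,
      u 0 * τ 5, u 2 * τ 5, 0]
  | 3, u, τ => ![-u 1 * τ 3 - u 3 * τ 5, u 0 * τ 3 - u 2 * τ 4, u 1 * τ 4 - u 4 * τ 5,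
      u 0 * τ 5, u 2 * τ 5, 0]
  | 4, u, τ => ![-u 1 * τ 4 - u 4 * τ 5, u 0 * τ 4, -u 3 * τ 5, u 2 * τ 5, u 0 * τ 5, 0]

theorem dotProduct_nilBracket_single (i : Fin 5) (u τ : Fin 6 → ℝ) (k : Fin 6) :
    τ ⬝ᵥ nilBracket i u (Pi.single k 1) = coadFun i u τ k := by
  fin_cases i <;> fin_cases k <;>
    simp [coadFun, nilBracket, wedge, dotProduct, Fin.sum_univ_six] <;> ring

theorem courantAlg_nilBracket (i : Fin 5) (a b : (Fin 6 → ℝ) × (Fin 6 → ℝ)) :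
    courantAlg (nilBracket i) a b =
      (nilBracket i a.1 b.1, coadFun i b.1 a.2 - coadFun i a.1 b.2) := by
  refine Prod.ext rfl (funext fun k => ?_)
  simp [courantAlg, dotProduct_nilBracket_single]

-- Once the coadjoint terms are written out by `coadFun`, this is a polynomial identity for each
-- algebra and each coordinate.
set_option maxHeartbeats 2000000 in
theorem genStruct_nijenhuis (i : Fin 5) (a b : (Fin 6 → ℝ) × (Fin 6 → ℝ)) :
    genStruct i (courantAlg (nilBracket i) a b
        - courantAlg (nilBracket i) (genStruct i a) (genStruct i b)) =
      courantAlg (nilBracket i) a (genStruct i b)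
        + courantAlg (nilBracket i) (genStruct i a) b := by
  simp only [courantAlg_nilBracket]
  obtain ⟨u, σ⟩ := a
  obtain ⟨v, τ⟩ := b
  ext k <;> fin_cases i <;> fin_cases k <;>
    simp [genStruct, genFun, nilBracket, wedge, coadFun] <;> ring

/-- The metrics `g^♭`. -/
def metricFun : Fin 5 → (Fin 6 → ℝ) → (Fin 6 → ℝ)
  | 0, u => ![u 0, -u 1, u 2, u 3, 4 * u 4 - 2 * u 5, 2 * u 5 - 2 * u 4]
  | 1, u => ![u 0, -u 1, u 2, u 3, 2 * u 4, 2 * u 5]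
  | 2, u => ![u 0, -u 1, u 2, u 3, u 4, u 5]
  | 3, u => ![u 0, -u 1, u 2, u 3, 2 * u 4, 2 * u 5]
  | 4, u => ![u 0, -u 1, u 2, -u 3, u 4, u 5]

/-- The inverse metrics `(g^♭)⁻¹`. -/
def metricInvFun : Fin 5 → (Fin 6 → ℝ) → (Fin 6 → ℝ)
  | 0, σ => ![σ 0, -σ 1, σ 2, σ 3, σ 4 / 2 + σ 5 / 2, σ 4 / 2 + σ 5]
  | 1, σ => ![σ 0, -σ 1, σ 2, σ 3, σ 4 / 2, σ 5 / 2]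
  | 2, σ => ![σ 0, -σ 1, σ 2, σ 3, σ 4, σ 5]
  | 3, σ => ![σ 0, -σ 1, σ 2, σ 3, σ 4 / 2, σ 5 / 2]
  | 4, σ => ![σ 0, -σ 1, σ 2, -σ 3, σ 4, σ 5]

/-- A pseudo-Riemannian metric on each of the five Lie algebras. -/
def metric (i : Fin 5) : (Fin 6 → ℝ) ≃ₗ[ℝ] (Fin 6 → ℝ) where
  toFun := metricFun i
  invFun := metricInvFun i
  map_add' a b := by
    ext k; fin_cases i <;> fin_cases k <;> simp [metricFun] <;> ring
  map_smul' c a := by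
    ext k; fin_cases i <;> fin_cases k <;> simp [metricFun] <;> ring
  left_inv a := by
    ext k; fin_cases i <;> fin_cases k <;> simp [metricFun, metricInvFun] <;> ring
  right_inv a := by
    ext k; fin_cases i <;> fin_cases k <;> simp [metricFun, metricInvFun] <;> ring

theorem metric_symm (i : Fin 5) (u v : Fin 6 → ℝ) : metric i u ⬝ᵥ v = metric i v ⬝ᵥ u := by
  fin_cases i <;> simp [metric, metricFun, dotProduct, Fin.sum_univ_six] <;> ring

/-- The coefficient form of `S I₋₁ = -I₋₁ S`. -/
theorem genStruct_metric (i : Fin 5) (a : (Fin 6 → ℝ) × (Fin 6 → ℝ)) :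
    genStruct i (-(metric i).symm a.2, metric i a.1) =
      -(-(metric i).symm (genStruct i a).2, metric i (genStruct i a).1) := by
  change genFun i (-metricInvFun i a.2) (metricFun i a.1) =
      -(-metricInvFun i (genFun i a.1 a.2).2, metricFun i (genFun i a.1 a.2).1)
  ext k <;> fin_cases i <;> fin_cases k <;>
    simp [genFun, metricFun, metricInvFun] <;> ring

end NilLie

end

noncomputable section

/-! ### Calculus with smooth functions and vector fields -/

namespace GenGeom

section Calculus

variable {n : ℕ} {M : Type*} [TopologicalSpace M] [ChartedSpace (EuclideanSpace ℝ (Fin n)) M]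

variable (n) in
/-- Smooth real functions. -/
abbrev IsSmoothFun (f : M → ℝ) : Prop := ContMDiff (𝓡 n) 𝓘(ℝ, ℝ) ∞ f

theorem IsSmoothFun.mdiffAt {f : M → ℝ} (hf : IsSmoothFun n f) (x : M) :
    MDifferentiableAt (𝓡 n) 𝓘(ℝ, ℝ) f x :=
  hf.mdifferentiable (by simp) x

theorem IsSmoothFun.mul' {f g : M → ℝ} (hf : IsSmoothFun n f) (hg : IsSmoothFun n g) :
    IsSmoothFun n (fun y => f y * g y) := hf.mul hg

theorem IsSmoothFun.sum' {ι : Type*} (s : Finset ι) {f : ι → M → ℝ}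
    (hf : ∀ i, IsSmoothFun n (f i)) : IsSmoothFun n (fun y => ∑ i ∈ s, f i y) :=
  contMDiff_finsetSum fun i _ => hf i

theorem dirDeriv_const (u : VField n M) (c : ℝ) (x : M) : dirDeriv u (fun _ => c) x = 0 := by
  rw [dirDeriv, mfderiv_const]
  rfl

theorem dirDeriv_add (u : VField n M) {f g : M → ℝ} (hf : IsSmoothFun n f)
    (hg : IsSmoothFun n g) (x : M) :
    dirDeriv u (fun y => f y + g y) x = dirDeriv u f x + dirDeriv u g x := by
  have h := ((hf.mdiffAt x).hasMFDerivAt.add (hg.mdiffAt x).hasMFDerivAt).mfderiv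
  exact congrArg (fun L => L (u x)) h

theorem dirDeriv_mul (u : VField n M) {f g : M → ℝ} (hf : IsSmoothFun n f)
    (hg : IsSmoothFun n g) (x : M) :
    dirDeriv u (fun y => f y * g y) x = dirDeriv u f x * g x + f x * dirDeriv u g x := by
  have h := ((hf.mdiffAt x).hasMFDerivAt.mul (hg.mdiffAt x).hasMFDerivAt).mfderiv
  have h2 := congrArg (fun L => L (u x)) h
  refine h2.trans ?_
  change f x * dirDeriv u g x + g x * dirDeriv u f x = _
  ring

theorem dirDeriv_sum (u : VField n M) {ι : Type*} (s : Finset ι) {f : ι → M → ℝ}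
    (hf : ∀ i, IsSmoothFun n (f i)) (x : M) :
    dirDeriv u (fun y => ∑ i ∈ s, f i y) x = ∑ i ∈ s, dirDeriv u (f i) x := by
  classical
  induction s using Finset.induction_on with
  | empty => simpa using dirDeriv_const u 0 x
  | insert a s ha ih =>
    simp only [Finset.sum_insert ha]
    rw [dirDeriv_add u (hf a) (IsSmoothFun.sum' s hf), ih]

theorem dirDeriv_const_mul (u : VField n M) {f : M → ℝ} (hf : IsSmoothFun n f) (c : ℝ) (x : M) :
    dirDeriv u (fun y => c * f y) x = c * dirDeriv u f x := by
  rw [dirDeriv_mul u contMDiff_const hf, dirDeriv_const]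
  ring

theorem dirDeriv_sub (u : VField n M) {f g : M → ℝ} (hf : IsSmoothFun n f)
    (hg : IsSmoothFun n g) (x : M) :
    dirDeriv u (fun y => f y - g y) x = dirDeriv u f x - dirDeriv u g x := by
  have h := dirDeriv_add u hf (IsSmoothFun.mul' (contMDiff_const (c := (-1 : ℝ))) hg) x
  rw [dirDeriv_const_mul u hg] at h
  simpa [sub_eq_add_neg] using h

theorem dirDeriv_sum_smul {ι : Type*} (s : Finset ι) (c : ι → M → ℝ) (u : ι → VField n M)
    (f : M → ℝ) (x : M) :
    dirDeriv (fun y => ∑ i ∈ s, c i y • u i y) f x = ∑ i ∈ s, c i x * dirDeriv (u i) f x := by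
  unfold dirDeriv
  rw [map_sum]
  refine Finset.sum_congr rfl fun i _ => ?_
  exact (mfderiv (𝓡 n) 𝓘(ℝ, ℝ) f x).map_smul (c i x) (u i x)

theorem bracket_swap (u v : VField n M) (x : M) : bracket u v x = -bracket v u x :=
  VectorField.mlieBracket_swap_apply

variable [IsManifold (𝓡 n) ∞ M]

theorem IsSmoothVField.mdiffAt {u : VField n M} (hu : IsSmoothVField u) (x : M) :
    MDifferentiableAt (𝓡 n) (𝓡 n).tangent (fun y => (⟨y, u y⟩ : TangentBundle (𝓡 n) M)) x :=
  ContMDiff.mdifferentiable hu (by simp) x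

/-- The function `u(f)` is the fibre component of the tangent map of `f` composed with the section
`u`. -/
theorem IsSmoothVField.dirDeriv {u : VField n M} (hu : IsSmoothVField u) {f : M → ℝ}
    (hf : IsSmoothFun n f) : IsSmoothFun n (dirDeriv u f) := by
  have h1 : ContMDiff (𝓡 n).tangent 𝓘(ℝ, ℝ).tangent ∞ (tangentMap (𝓡 n) 𝓘(ℝ, ℝ) f) :=
    ContMDiff.contMDiff_tangentMap hf (by simp)
  exact (contMDiff_snd_tangentBundle_modelSpace ℝ 𝓘(ℝ, ℝ)).comp (h1.comp hu)

theorem IsSmoothVField.smul {u : VField n M} (hu : IsSmoothVField u) {f : M → ℝ}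
    (hf : IsSmoothFun n f) : IsSmoothVField (fun y => f y • u y) :=
  ContMDiff.smul_section hf hu

theorem IsSmoothVField.sum {ι : Type*} (s : Finset ι) {u : ι → VField n M}
    (hu : ∀ i, IsSmoothVField (u i)) : IsSmoothVField (fun y => ∑ i ∈ s, u i y) :=
  ContMDiff.sum_section fun i _ => hu i

theorem bracket_smul_right (u : VField n M) {v : VField n M} (hv : IsSmoothVField v) {f : M → ℝ}
    (hf : IsSmoothFun n f) (x : M) :
    bracket u (fun y => f y • v y) x = dirDeriv u f x • v x + f x • bracket u v x :=
  VectorField.mlieBracket_smul_right (hf.mdiffAt x) (hv.mdiffAt x)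

theorem bracket_sum_right (u : VField n M) {ι : Type*} (s : Finset ι) {v : ι → VField n M}
    (hv : ∀ i, IsSmoothVField (v i)) (x : M) :
    bracket u (fun y => ∑ i ∈ s, v i y) x = ∑ i ∈ s, bracket u (v i) x := by
  classical
  induction s using Finset.induction_on with
  | empty =>
    have : (fun y : M => ∑ i ∈ (∅ : Finset ι), v i y) = 0 := by funext y; simp
    rw [this, bracket, VectorField.mlieBracket_zero_right]
    rfl
  | insert a s ha ih =>
    simp only [Finset.sum_insert ha]
    rw [← ih]
    exact VectorField.mlieBracket_add_right ((hv a).mdiffAt x)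
      ((IsSmoothVField.sum s hv).mdiffAt x)

/-- The Leibniz rule is applied in the second argument, and transferred to the first by
antisymmetry. -/
theorem bracket_sum_smul (c d : Fin n → M → ℝ) (E : Fin n → VField n M)
    (hc : ∀ i, IsSmoothFun n (c i)) (hd : ∀ i, IsSmoothFun n (d i))
    (hE : ∀ i, IsSmoothVField (E i)) (x : M) :
    bracket (fun y => ∑ i, c i y • E i y) (fun y => ∑ j, d j y • E j y) x =
      (∑ j, dirDeriv (fun y => ∑ i, c i y • E i y) (d j) x • E j x)
      - (∑ i, dirDeriv (fun y => ∑ j, d j y • E j y) (c i) x • E i x)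
      + ∑ i, ∑ j, (c i x * d j x) • bracket (E i) (E j) x := by
  have key (j : Fin n) : bracket (E j) (fun y => ∑ i, c i y • E i y) x =
      (∑ i, dirDeriv (E j) (c i) x • E i x) + ∑ i, c i x • bracket (E j) (E i) x := by
    rw [bracket_sum_right _ _ (fun i => (hE i).smul (hc i)), ← Finset.sum_add_distrib]
    exact Finset.sum_congr rfl fun i _ => bracket_smul_right _ (hE i) (hc i) x
  rw [bracket_sum_right _ _ (fun i => (hE i).smul (hd i))]
  simp only [bracket_smul_right _ (hE _) (hd _)]
  rw [Finset.sum_add_distrib, sub_eq_add_neg, add_assoc]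
  congr 1
  have h2 (j : Fin n) : bracket (fun y => ∑ i, c i y • E i y) (E j) x =
      -((∑ i, dirDeriv (E j) (c i) x • E i x) + ∑ i, c i x • bracket (E j) (E i) x) := by
    rw [bracket_swap, key]
  simp only [h2, smul_neg, smul_add, Finset.smul_sum, Finset.sum_add_distrib,
    Finset.sum_neg_distrib, neg_add, dirDeriv_sum_smul, Finset.sum_smul, smul_smul]
  congr 1
  · rw [Finset.sum_comm]
  · rw [Finset.sum_comm, ← Finset.sum_neg_distrib]
    refine Finset.sum_congr rfl fun i _ => ?_
    rw [← Finset.sum_neg_distrib]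
    refine Finset.sum_congr rfl fun j _ => ?_
    rw [bracket_swap (E j) (E i), smul_neg, neg_neg, mul_comm]

end Calculus

end GenGeom

end

noncomputable section

/-! ### Parallelizations by vector fields with constant structure functions -/

namespace GenGeom

section Frame

open Bundle

variable {n : ℕ}

/-- A global smooth frame of the tangent bundle, with values given by linear isomorphisms
`ℝⁿ ≃ T_x M`, whose brackets have constant coefficients. -/
structure InvFrame (n : ℕ) (M : Type*) [TopologicalSpace M]
    [ChartedSpace (EuclideanSpace ℝ (Fin n)) M] [IsManifold (𝓡 n) ∞ M]
    (B : (Fin n → ℝ) →ₗ[ℝ] (Fin n → ℝ) →ₗ[ℝ] (Fin n → ℝ)) where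
  /-- the isomorphisms `ℝⁿ ≃ T_x M` -/
  toEquiv : ∀ x : M, (Fin n → ℝ) ≃ₗ[ℝ] TangentSpace (𝓡 n) x
  smooth : ∀ v, IsSmoothVField (fun x => toEquiv x v)
  bracket_eq : ∀ v w x,
    bracket (fun y => toEquiv y v) (fun y => toEquiv y w) x = toEquiv x (B v w)

variable {M : Type*} [TopologicalSpace M] [ChartedSpace (EuclideanSpace ℝ (Fin n)) M]
  [IsManifold (𝓡 n) ∞ M] {B : (Fin n → ℝ) →ₗ[ℝ] (Fin n → ℝ) →ₗ[ℝ] (Fin n → ℝ)}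

namespace InvFrame

variable (F : InvFrame n M B)

/-- The `k`-th vector field of the frame. -/
def field (k : Fin n) : VField n M := fun x => F.toEquiv x (Pi.single k 1)

theorem smooth_field (k : Fin n) : IsSmoothVField (F.field k) := F.smooth _

theorem toEquiv_eq_sum (x : M) (v : Fin n → ℝ) : F.toEquiv x v = ∑ k, v k • F.field k x :=
  NilLie.map_eq_sum_single (F.toEquiv x).toLinearMap v

/-- The coefficients of a vector field with respect to the frame. -/
def coeff (u : VField n M) (x : M) : Fin n → ℝ := (F.toEquiv x).symm (u x)

theorem toEquiv_coeff (u : VField n M) (x : M) : F.toEquiv x (F.coeff u x) = u x :=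
  (F.toEquiv x).apply_symm_apply _

theorem isSmoothVField_toEquiv {a : M → Fin n → ℝ} (ha : ∀ k, IsSmoothFun n (fun x => a x k)) :
    IsSmoothVField (fun x => F.toEquiv x (a x)) := by
  simp only [toEquiv_eq_sum]
  exact IsSmoothVField.sum _ fun k => (F.smooth_field k).smul (ha k)

/-- In a local trivialization the frame becomes a smooth family `A y` of invertible linear maps, and
the coefficients of `u` are `(A y)⁻¹` applied to the local expression of `u`. Inversion is smooth at
invertible maps. -/
theorem smooth_coeff {u : VField n M} (hu : IsSmoothVField u) (k : Fin n) :
    IsSmoothFun n (fun x => F.coeff u x k) := by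
  intro x₀
  let V := EuclideanSpace ℝ (Fin n)
  let e := trivializationAt V (TangentSpace (𝓡 n) : M → Type _) x₀
  have hx₀ : x₀ ∈ e.baseSet := mem_baseSet_trivializationAt _ _ _
  have hread {w : VField n M} (hw : IsSmoothVField w) :
      ContMDiffAt (𝓡 n) 𝓘(ℝ, V) ∞ (fun y => (e ⟨y, w y⟩).2) x₀ :=
    (contMDiffAt_section x₀).1 (hw x₀)
  let A : M → ((Fin n → ℝ) →L[ℝ] V) := fun y =>
    ∑ j, (ContinuousLinearMap.smulRightL ℝ (Fin n → ℝ) V (ContinuousLinearMap.proj j))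
      (e ⟨y, F.field j y⟩).2
  have hA : ContMDiffAt (𝓡 n) 𝓘(ℝ, (Fin n → ℝ) →L[ℝ] V) ∞ A x₀ := by
    refine contMDiffAt_finsetSum fun j _ => ?_
    exact ((ContinuousLinearMap.smulRightL ℝ (Fin n → ℝ) V
      (ContinuousLinearMap.proj j)).contMDiff).contMDiffAt.comp x₀ (hread (F.smooth_field j))
  have hA_apply (y : M) (hy : y ∈ e.baseSet) (v : Fin n → ℝ) :
      A y v = (e ⟨y, F.toEquiv y v⟩).2 := by
    have h := map_sum (e.continuousLinearEquivAt ℝ y hy) (fun j => v j • F.field j y) Finset.univ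
    rw [← F.toEquiv_eq_sum] at h
    refine Eq.trans ?_ h.symm
    simp only [A, sum_apply, map_smul]
    rfl
  let L (y : M) (hy : y ∈ e.baseSet) : (Fin n → ℝ) ≃L[ℝ] V :=
    ((F.toEquiv y).trans (e.continuousLinearEquivAt ℝ y hy).toLinearEquiv).toContinuousLinearEquiv
  have hAL (y : M) (hy : y ∈ e.baseSet) : A y = L y hy := by
    ext1 v
    exact hA_apply y hy v
  have hinv : ContMDiffAt (𝓡 n) 𝓘(ℝ, V →L[ℝ] (Fin n → ℝ)) ∞
      (fun y => ContinuousLinearMap.inverse (A y)) x₀ := by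
    have h := contDiffAt_map_inverse (n := ∞) (L x₀ hx₀)
    rw [← hAL] at h
    exact h.contMDiffAt.comp x₀ hA
  have h := hinv.clm_apply (hread hu)
  have hk : ContMDiffAt (𝓡 n) 𝓘(ℝ, ℝ) ∞
      (fun y => ContinuousLinearMap.inverse (A y) (e ⟨y, u y⟩).2 k) x₀ :=
    ((ContinuousLinearMap.proj (R := ℝ) (φ := fun _ : Fin n => ℝ) k).contMDiff).contMDiffAt.comp
      x₀ h
  -- The formula holds only over the base set of the trivialization, a neighbourhood of `x₀`.
  refine hk.congr_of_eventuallyEq ?_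
  filter_upwards [e.open_baseSet.mem_nhds hx₀] with y hy
  rw [hAL y hy, ContinuousLinearMap.inverse_equiv]
  refine congrFun (Eq.symm ?_) k
  rw [ContinuousLinearEquiv.coe_coe, ContinuousLinearEquiv.symm_apply_eq]
  change _ = (e ⟨y, F.toEquiv y (F.coeff u y)⟩).2
  rw [F.toEquiv_coeff]

end InvFrame

end Frame

end GenGeom

end

noncomputable section

/-! ### The Courant bracket in a frame -/

namespace GenGeom

open Matrix NilLie

section Derivative

variable {n : ℕ} {M : Type*} [TopologicalSpace M] [ChartedSpace (EuclideanSpace ℝ (Fin n)) M]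

/-- Smooth vector valued functions. -/
def IsSmoothVec (a : M → Fin n → ℝ) : Prop := ∀ k, IsSmoothFun n (fun x => a x k)

/-- The derivative of a vector valued function along a vector field. -/
def vecDeriv (u : VField n M) (a : M → Fin n → ℝ) (x : M) : Fin n → ℝ :=
  fun k => dirDeriv u (fun y => a y k) x

theorem IsSmoothVec.dotProduct {a b : M → Fin n → ℝ} (ha : IsSmoothVec a) (hb : IsSmoothVec b) :
    IsSmoothFun n (fun x => a x ⬝ᵥ b x) :=
  IsSmoothFun.sum' _ fun k => (ha k).mul' (hb k)

theorem IsSmoothVec.add {a b : M → Fin n → ℝ} (ha : IsSmoothVec a) (hb : IsSmoothVec b) :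
    IsSmoothVec (fun x => a x + b x) := fun k => ContMDiff.add (ha k) (hb k)

theorem IsSmoothVec.sub {a b : M → Fin n → ℝ} (ha : IsSmoothVec a) (hb : IsSmoothVec b) :
    IsSmoothVec (fun x => a x - b x) := fun k => ContMDiff.sub (ha k) (hb k)

theorem isSmoothVec_const (v : Fin n → ℝ) : IsSmoothVec (fun _ : M => v) :=
  fun _ => contMDiff_const

theorem IsSmoothVec.functional {a : M → Fin n → ℝ} (ha : IsSmoothVec a)
    (f : (Fin n → ℝ) →ₗ[ℝ] ℝ) : IsSmoothFun n (fun x => f (a x)) := by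
  rw [funext fun x => map_eq_sum_single f (a x)]
  exact IsSmoothFun.sum' _ fun k => (ha k).mul' contMDiff_const

theorem IsSmoothVec.map {a : M → Fin n → ℝ} (ha : IsSmoothVec a)
    (f : (Fin n → ℝ) →ₗ[ℝ] (Fin n → ℝ)) : IsSmoothVec (fun x => f (a x)) :=
  fun k => ha.functional ((LinearMap.proj k : (Fin n → ℝ) →ₗ[ℝ] ℝ) ∘ₗ f)

theorem IsSmoothVec.map₂ {a b : M → Fin n → ℝ} (ha : IsSmoothVec a) (hb : IsSmoothVec b)
    (f : (Fin n → ℝ) →ₗ[ℝ] (Fin n → ℝ) →ₗ[ℝ] (Fin n → ℝ)) :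
    IsSmoothVec (fun x => f (a x) (b x)) := by
  intro k
  simp only [map_eq_sum_single f (a _), LinearMap.sum_apply, LinearMap.smul_apply, Finset.sum_apply,
    Pi.smul_apply, smul_eq_mul]
  exact IsSmoothFun.sum' _ fun j => (ha j).mul' (hb.map (f (Pi.single j 1)) k)

theorem dirDeriv_functional (u : VField n M) {a : M → Fin n → ℝ} (ha : IsSmoothVec a)
    (f : (Fin n → ℝ) →ₗ[ℝ] ℝ) (x : M) :
    dirDeriv u (fun y => f (a y)) x = f (vecDeriv u a x) := by
  rw [funext fun y => map_eq_sum_single f (a y), map_eq_sum_single f (vecDeriv u a x)]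
  simp only [smul_eq_mul]
  rw [dirDeriv_sum u _ fun k => (ha k).mul' contMDiff_const]
  refine Finset.sum_congr rfl fun k _ => ?_
  rw [dirDeriv_mul u (ha k) contMDiff_const, dirDeriv_const, mul_zero, add_zero]
  rfl

theorem vecDeriv_map (u : VField n M) {a : M → Fin n → ℝ} (ha : IsSmoothVec a)
    (f : (Fin n → ℝ) →ₗ[ℝ] (Fin n → ℝ)) (x : M) :
    vecDeriv u (fun y => f (a y)) x = f (vecDeriv u a x) :=
  funext fun k => dirDeriv_functional u ha ((LinearMap.proj k : (Fin n → ℝ) →ₗ[ℝ] ℝ) ∘ₗ f) x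

theorem vecDeriv_add (u : VField n M) {a b : M → Fin n → ℝ} (ha : IsSmoothVec a)
    (hb : IsSmoothVec b) (x : M) :
    vecDeriv u (fun y => a y + b y) x = vecDeriv u a x + vecDeriv u b x :=
  funext fun k => dirDeriv_add u (ha k) (hb k) x

theorem dirDeriv_dotProduct (u : VField n M) {a b : M → Fin n → ℝ} (ha : IsSmoothVec a)
    (hb : IsSmoothVec b) (x : M) :
    dirDeriv u (fun y => a y ⬝ᵥ b y) x = vecDeriv u a x ⬝ᵥ b x + a x ⬝ᵥ vecDeriv u b x := by
  simp only [dotProduct]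
  rw [dirDeriv_sum u _ fun k => (ha k).mul' (hb k), ← Finset.sum_add_distrib]
  exact Finset.sum_congr rfl fun k _ => dirDeriv_mul u (ha k) (hb k) x

variable [IsManifold (𝓡 n) ∞ M]

theorem IsSmoothVec.vecDeriv {u : VField n M} (hu : IsSmoothVField u) {a : M → Fin n → ℝ}
    (ha : IsSmoothVec a) : IsSmoothVec (vecDeriv u a) :=
  fun k => hu.dirDeriv (ha k)

end Derivative

section Courant

variable {n : ℕ} {M : Type*} [TopologicalSpace M] [ChartedSpace (EuclideanSpace ℝ (Fin n)) M]
  [IsManifold (𝓡 n) ∞ M] {B : (Fin n → ℝ) →ₗ[ℝ] (Fin n → ℝ) →ₗ[ℝ] (Fin n → ℝ)}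

namespace InvFrame

variable (F : InvFrame n M B)

theorem isSmoothVec_coeff {u : VField n M} (hu : IsSmoothVField u) : IsSmoothVec (F.coeff u) :=
  fun k => F.smooth_coeff hu k

/-- The vector field with given coefficients. -/
def ofCoeff (a : M → Fin n → ℝ) : VField n M := fun x => F.toEquiv x (a x)

theorem ofCoeff_coeff (u : VField n M) : F.ofCoeff (F.coeff u) = u :=
  funext fun x => F.toEquiv_coeff u x

theorem bracket_ofCoeff {a b : M → Fin n → ℝ} (ha : IsSmoothVec a) (hb : IsSmoothVec b) (x : M) :
    bracket (F.ofCoeff a) (F.ofCoeff b) x =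
      F.toEquiv x (vecDeriv (F.ofCoeff a) b x - vecDeriv (F.ofCoeff b) a x + B (a x) (b x)) := by
  have h (c : M → Fin n → ℝ) : F.ofCoeff c = fun y => ∑ k, c y k • F.field k y :=
    funext fun y => F.toEquiv_eq_sum y (c y)
  have hbr := bracket_sum_smul (fun k y => a y k) (fun k y => b y k) F.field ha hb F.smooth_field x
  rw [← h, ← h] at hbr
  rw [hbr, map_add, map_sub, F.toEquiv_eq_sum x (vecDeriv _ b x),
    F.toEquiv_eq_sum x (vecDeriv _ a x)]
  congr 1
  rw [map_eq_sum_single B (a x)]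
  simp only [LinearMap.sum_apply, LinearMap.smul_apply, map_sum, map_smul]
  refine Finset.sum_congr rfl fun i _ => ?_
  rw [map_eq_sum_single (B (Pi.single i 1)) (b x)]
  simp only [map_sum, map_smul, Finset.smul_sum, smul_smul]
  refine Finset.sum_congr rfl fun j _ => ?_
  congr 1
  exact F.bracket_eq _ _ _

theorem dirDeriv_ofCoeff (a : M → Fin n → ℝ) (f : M → ℝ) (x : M) :
    dirDeriv (F.ofCoeff a) f x = ∑ k, a x k * dirDeriv (F.field k) f x := by
  have h : F.ofCoeff a = fun y => ∑ k, a y k • F.field k y :=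
    funext fun y => F.toEquiv_eq_sum y (a y)
  rw [h, dirDeriv_sum_smul Finset.univ (fun k y => a y k)]

theorem vecDeriv_ofCoeff (a b : M → Fin n → ℝ) (x : M) :
    vecDeriv (F.ofCoeff a) b x = ∑ k, a x k • vecDeriv (F.field k) b x := by
  funext j
  simp [vecDeriv, dirDeriv_ofCoeff]

/-- The isomorphisms `ℝⁿ ⊕ (ℝⁿ)^* ≃ T_x M ⊕ T_x^* M` of the frame and its dual frame. -/
def genEquiv (x : M) : ((Fin n → ℝ) × (Fin n → ℝ)) ≃ₗ[ℝ] GenTangent n x :=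
  (F.toEquiv x).prodCongr ((dotProductEquiv ℝ (Fin n)).trans (F.toEquiv x).symm.dualMap)

theorem genEquiv_fst (x : M) (a : (Fin n → ℝ) × (Fin n → ℝ)) :
    (F.genEquiv x a).1 = F.toEquiv x a.1 := rfl

theorem genEquiv_snd (x : M) (a : (Fin n → ℝ) × (Fin n → ℝ)) (w : TangentSpace (𝓡 n) x) :
    (F.genEquiv x a).2 w = a.2 ⬝ᵥ (F.toEquiv x).symm w := rfl

theorem pairing_genEquiv (x : M) (a b : (Fin n → ℝ) × (Fin n → ℝ)) :
    pairing (F.genEquiv x a) (F.genEquiv x b) = dualPairing a b := by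
  simp [pairing, genEquiv_fst, genEquiv_snd, dualPairing]

/-- The coefficients of a section of the extended tangent bundle. -/
def genCoeff (s : GenField n M) (x : M) : (Fin n → ℝ) × (Fin n → ℝ) := (F.genEquiv x).symm (s x)

theorem genEquiv_genCoeff (s : GenField n M) (x : M) : F.genEquiv x (F.genCoeff s x) = s x :=
  (F.genEquiv x).apply_symm_apply _

/-- Sections of the extended tangent bundle are smooth if and only if their coefficients are. -/
theorem isSmoothGenField_iff (s : GenField n M) : IsSmoothGenField s ↔
    IsSmoothVec (fun x => (F.genCoeff s x).1) ∧ IsSmoothVec (fun x => (F.genCoeff s x).2) := by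
  have h1 (x : M) : (s x).1 = F.toEquiv x (F.genCoeff s x).1 := by
    rw [← genEquiv_fst, genEquiv_genCoeff]
  have h2 (x : M) (w : TangentSpace (𝓡 n) x) :
      (s x).2 w = (F.genCoeff s x).2 ⬝ᵥ (F.toEquiv x).symm w := by
    rw [← genEquiv_snd, genEquiv_genCoeff]
  constructor
  · rintro ⟨hs1, hs2⟩
    constructor
    · have h := F.isSmoothVec_coeff hs1
      refine fun k => (h k).congr fun x => ?_
      rw [coeff, h1, LinearEquiv.symm_apply_apply]
    · refine fun k => (hs2 _ (F.smooth_field k)).congr fun x => ?_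
      rw [h2, field, LinearEquiv.symm_apply_apply]
      simp
  · rintro ⟨hs1, hs2⟩
    constructor
    · have h := F.isSmoothVField_toEquiv hs1
      simpa only [← h1] using h
    · intro w hw
      simp only [h2]
      exact hs2.dotProduct (F.isSmoothVec_coeff hw)

end InvFrame

end Courant

end GenGeom

end

/-! ### Derivatives of generalized sections and the coefficients of their Courant bracket -/

noncomputable section

namespace GenGeom

open Matrix NilLie

section GenDerivative

variable {n : ℕ} {M : Type*} [TopologicalSpace M] [ChartedSpace (EuclideanSpace ℝ (Fin n)) M]

/-- Smooth functions with values in `ℝⁿ ⊕ (ℝⁿ)^*`. -/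
def IsSmoothGenVec (a : M → (Fin n → ℝ) × (Fin n → ℝ)) : Prop :=
  IsSmoothVec (fun x => (a x).1) ∧ IsSmoothVec (fun x => (a x).2)

/-- The derivative along a vector field of a function with values in `ℝⁿ ⊕ (ℝⁿ)^*`. -/
def genDeriv (u : VField n M) (a : M → (Fin n → ℝ) × (Fin n → ℝ)) (x : M) :
    (Fin n → ℝ) × (Fin n → ℝ) :=
  (vecDeriv u (fun y => (a y).1) x, vecDeriv u (fun y => (a y).2) x)

/-- A linear map with constant coefficients commutes with differentiation; applied to `S`, this
keeps derivatives of eigensections in the eigenspaces. -/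
theorem genDeriv_map (u : VField n M) {a : M → (Fin n → ℝ) × (Fin n → ℝ)} (ha : IsSmoothGenVec a)
    (f : (Fin n → ℝ) × (Fin n → ℝ) →ₗ[ℝ] (Fin n → ℝ) × (Fin n → ℝ)) (x : M) :
    genDeriv u (fun y => f (a y)) x = f (genDeriv u a x) := by
  have key (p : (Fin n → ℝ) × (Fin n → ℝ) →ₗ[ℝ] (Fin n → ℝ)) :
      vecDeriv u (fun y => p (a y)) x = p (genDeriv u a x) := by
    have hp (z : (Fin n → ℝ) × (Fin n → ℝ)) :
        p z = (p ∘ₗ LinearMap.inl ℝ _ _) z.1 + (p ∘ₗ LinearMap.inr ℝ _ _) z.2 := by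
      rw [LinearMap.comp_apply, LinearMap.comp_apply, ← map_add]
      simp
    rw [funext fun y => hp (a y), hp (genDeriv u a x), vecDeriv_add u (ha.1.map _) (ha.2.map _),
      vecDeriv_map u ha.1, vecDeriv_map u ha.2]
    rfl
  exact Prod.ext (key (LinearMap.fst ℝ _ _ ∘ₗ f)) (key (LinearMap.snd ℝ _ _ ∘ₗ f))

theorem genDeriv_smul (u : VField n M) {a : M → (Fin n → ℝ) × (Fin n → ℝ)}
    (ha : IsSmoothGenVec a) (c : ℝ) (x : M) :
    genDeriv u (fun y => c • a y) x = c • genDeriv u a x :=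
  genDeriv_map u ha (c • LinearMap.id) x

theorem IsSmoothGenVec.map {a : M → (Fin n → ℝ) × (Fin n → ℝ)} (ha : IsSmoothGenVec a)
    (f : (Fin n → ℝ) × (Fin n → ℝ) →ₗ[ℝ] (Fin n → ℝ) × (Fin n → ℝ)) :
    IsSmoothGenVec (fun x => f (a x)) := by
  have key (p : (Fin n → ℝ) × (Fin n → ℝ) →ₗ[ℝ] (Fin n → ℝ)) :
      IsSmoothVec (fun y => p (a y)) := by
    have hp (z : (Fin n → ℝ) × (Fin n → ℝ)) :
        p z = (p ∘ₗ LinearMap.inl ℝ _ _) z.1 + (p ∘ₗ LinearMap.inr ℝ _ _) z.2 := by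
      rw [LinearMap.comp_apply, LinearMap.comp_apply, ← map_add]
      simp
    rw [funext fun y => hp (a y)]
    exact (ha.1.map _).add (ha.2.map _)
  exact ⟨key (LinearMap.fst ℝ _ _ ∘ₗ f), key (LinearMap.snd ℝ _ _ ∘ₗ f)⟩

theorem IsSmoothGenVec.add {a b : M → (Fin n → ℝ) × (Fin n → ℝ)} (ha : IsSmoothGenVec a)
    (hb : IsSmoothGenVec b) : IsSmoothGenVec (fun x => a x + b x) :=
  ⟨ha.1.add hb.1, ha.2.add hb.2⟩

theorem IsSmoothGenVec.sub {a b : M → (Fin n → ℝ) × (Fin n → ℝ)} (ha : IsSmoothGenVec a)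
    (hb : IsSmoothGenVec b) : IsSmoothGenVec (fun x => a x - b x) :=
  ⟨ha.1.sub hb.1, ha.2.sub hb.2⟩

theorem IsSmoothGenVec.dualPairing {a b : M → (Fin n → ℝ) × (Fin n → ℝ)} (ha : IsSmoothGenVec a)
    (hb : IsSmoothGenVec b) : IsSmoothFun n (fun x => dualPairing (a x) (b x)) :=
  ContMDiff.add (hb.2.dotProduct ha.1) (ha.2.dotProduct hb.1)

end GenDerivative

section Courant

variable {n : ℕ} {M : Type*} [TopologicalSpace M] [ChartedSpace (EuclideanSpace ℝ (Fin n)) M]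
  [IsManifold (𝓡 n) ∞ M] {B : (Fin n → ℝ) →ₗ[ℝ] (Fin n → ℝ) →ₗ[ℝ] (Fin n → ℝ)}

theorem IsSmoothGenVec.genDeriv {u : VField n M} (hu : IsSmoothVField u)
    {a : M → (Fin n → ℝ) × (Fin n → ℝ)} (ha : IsSmoothGenVec a) : IsSmoothGenVec (genDeriv u a) :=
  ⟨ha.1.vecDeriv hu, ha.2.vecDeriv hu⟩

namespace InvFrame

variable (F : InvFrame n M B)

/-- The coefficients of the Courant bracket of sections with coefficients `a` and `b`. -/
def courantCoeff (a b : M → (Fin n → ℝ) × (Fin n → ℝ)) (x : M) : (Fin n → ℝ) × (Fin n → ℝ) :=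
  courantAlg (fun v w => B v w) (a x) (b x)
    + (genDeriv (F.ofCoeff fun y => (a y).1) b x - genDeriv (F.ofCoeff fun y => (b y).1) a x)
    + (0, fun k => 1 / 2 * (dualPairing (genDeriv (F.field k) a x) (b x)
        - dualPairing (a x) (genDeriv (F.field k) b x)))

/-- The derivative of `w` along `u` occurs in both `u(τ(w))` and `τ([u, w])` and cancels, so the
result is tensorial in `w`. -/
theorem lieDerivForm_ofCoeff {u τ w : M → Fin n → ℝ} (hu : IsSmoothVec u) (hτ : IsSmoothVec τ)
    (hw : IsSmoothVec w) (t : ∀ x : M, Module.Dual ℝ (TangentSpace (𝓡 n) x))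
    (ht : ∀ x v, t x v = τ x ⬝ᵥ (F.toEquiv x).symm v) (x : M) :
    lieDerivForm (F.ofCoeff u) t (F.ofCoeff w) x =
      vecDeriv (F.ofCoeff u) τ x ⬝ᵥ w x + τ x ⬝ᵥ vecDeriv (F.ofCoeff w) u x
        - τ x ⬝ᵥ B (u x) (w x) := by
  have h : (fun y => t y (F.ofCoeff w y)) = fun y => τ y ⬝ᵥ w y := by
    funext y
    rw [ht, ofCoeff, LinearEquiv.symm_apply_apply]
  rw [lieDerivForm, h, dirDeriv_dotProduct _ hτ hw, F.bracket_ofCoeff hu hw, ht,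
    LinearEquiv.symm_apply_apply, dotProduct_add, dotProduct_sub]
  ring

/-- With `a = u + σ` and `b = v + τ`, the Lie derivatives contribute `τ · D_k u - σ · D_k v`.
Subtracting half of `D_k (τ · u - σ · v)` leaves `½ (⟨D_k a, b⟩ - ⟨a, D_k b⟩)`, the last summand of
`courantCoeff`. -/
theorem isCourantBracket_courantCoeff {a b : M → (Fin n → ℝ) × (Fin n → ℝ)}
    (ha : IsSmoothGenVec a) (hb : IsSmoothGenVec b) :
    IsCourantBracket (fun x => F.genEquiv x (a x)) (fun x => F.genEquiv x (b x))
      (fun x => F.genEquiv x (F.courantCoeff a b x)) := by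
  constructor
  · intro x
    rw [genEquiv_fst]
    refine Eq.trans ?_ (F.bracket_ofCoeff ha.1 hb.1 x).symm
    congr 1
    simp only [courantCoeff, courantAlg, genDeriv, Prod.fst_add, Prod.fst_sub, add_zero]
    abel
  · intro w hw x
    obtain ⟨c, rfl, hc⟩ : ∃ c, w = F.ofCoeff c ∧ IsSmoothVec c :=
      ⟨F.coeff w, (F.ofCoeff_coeff w).symm, F.isSmoothVec_coeff hw⟩
    have h1 := F.lieDerivForm_ofCoeff ha.1 hb.2 hc (fun y => (F.genEquiv y (b y)).2)
      (fun y v => F.genEquiv_snd y (b y) v) x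
    have h2 := F.lieDerivForm_ofCoeff hb.1 ha.2 hc (fun y => (F.genEquiv y (a y)).2)
      (fun y v => F.genEquiv_snd y (a y) v) x
    have h3 : (fun y => (F.genEquiv y (b y)).2 (F.genEquiv y (a y)).1
        - (F.genEquiv y (a y)).2 (F.genEquiv y (b y)).1) =
        fun y => (b y).2 ⬝ᵥ (a y).1 - (a y).2 ⬝ᵥ (b y).1 := by
      funext y
      simp only [genEquiv_snd, genEquiv_fst, LinearEquiv.symm_apply_apply]
    rw [h3, dirDeriv_sub _ (hb.2.dotProduct ha.1) (ha.2.dotProduct hb.1),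
      dirDeriv_dotProduct _ hb.2 ha.1, dirDeriv_dotProduct _ ha.2 hb.1]
    refine Eq.trans ?_ (congrArg₂ (· - ·) (congrArg₂ (· - ·) h1.symm h2.symm) rfl)
    have hx : (F.toEquiv x).symm (F.ofCoeff c x) = c x := (F.toEquiv x).symm_apply_apply _
    rw [genEquiv_snd, hx]
    have hB (v τ : Fin n → ℝ) : τ ⬝ᵥ B v (c x) = ∑ k, c x k * (τ ⬝ᵥ B v (Pi.single k 1)) := by
      rw [map_eq_sum_single (B v) (c x), dotProduct_sum]
      simp [dotProduct_smul]
    have hD (τ : Fin n → ℝ) (d : M → Fin n → ℝ) :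
        τ ⬝ᵥ vecDeriv (F.ofCoeff c) d x = ∑ k, c x k * (τ ⬝ᵥ vecDeriv (F.field k) d x) := by
      rw [vecDeriv_ofCoeff, dotProduct_sum]
      simp [dotProduct_smul]
    have hD' (τ : Fin n → ℝ) (d : M → Fin n → ℝ) :
        vecDeriv (F.ofCoeff c) d x ⬝ᵥ τ = ∑ k, c x k * (vecDeriv (F.field k) d x ⬝ᵥ τ) := by
      rw [vecDeriv_ofCoeff, sum_dotProduct]
      simp [smul_dotProduct]
    have hc1 (τ : Fin n → ℝ) : τ ⬝ᵥ c x = ∑ k, c x k * τ k := dotProduct_comm _ _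
    -- Both sides are now linear in the coefficients of `w`, without derivatives of them, and are
    -- compared for each frame field.
    simp only [hc1, hB, hD, hD']
    simp only [← Finset.sum_add_distrib, ← Finset.sum_sub_distrib, Finset.mul_sum]
    refine Finset.sum_congr rfl fun k _ => ?_
    simp only [courantCoeff, courantAlg, genDeriv, Prod.snd_add, Prod.snd_sub, dualPairing,
      Pi.add_apply, Pi.sub_apply]
    ring

/-- The field of endomorphisms of the extended tangent bundle with constant coefficients. -/
def constGenEnd (S : (Fin n → ℝ) × (Fin n → ℝ) →ₗ[ℝ] (Fin n → ℝ) × (Fin n → ℝ)) :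
    GenEndField n M :=
  fun x => (F.genEquiv x).toLinearMap ∘ₗ S ∘ₗ (F.genEquiv x).symm.toLinearMap

theorem constGenEnd_genEquiv (S : (Fin n → ℝ) × (Fin n → ℝ) →ₗ[ℝ] (Fin n → ℝ) × (Fin n → ℝ))
    (x : M) (a : (Fin n → ℝ) × (Fin n → ℝ)) :
    F.constGenEnd S x (F.genEquiv x a) = F.genEquiv x (S a) := by
  simp [constGenEnd]

theorem isSmoothGenField_genEquiv (a : M → (Fin n → ℝ) × (Fin n → ℝ)) :
    IsSmoothGenField (fun x => F.genEquiv x (a x)) ↔ IsSmoothGenVec a := by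
  rw [F.isSmoothGenField_iff]
  simp [genCoeff, IsSmoothGenVec]

theorem exists_eq_genEquiv (s : GenField n M) : ∃ a : M → (Fin n → ℝ) × (Fin n → ℝ),
    s = fun x => F.genEquiv x (a x) :=
  ⟨F.genCoeff s, funext fun x => (F.genEquiv_genCoeff s x).symm⟩

end InvFrame

theorem IsSmoothGenVec.courantCoeff (F : InvFrame n M B) {a b : M → (Fin n → ℝ) × (Fin n → ℝ)}
    (ha : IsSmoothGenVec a) (hb : IsSmoothGenVec b) : IsSmoothGenVec (F.courantCoeff a b) := by
  have hEa := F.isSmoothVField_toEquiv ha.1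
  have hEb := F.isSmoothVField_toEquiv hb.1
  refine IsSmoothGenVec.add (IsSmoothGenVec.add ?_ ((hb.genDeriv hEa).sub (ha.genDeriv hEb))) ?_
  · exact ⟨ha.1.map₂ hb.1 B, fun k => ContMDiff.sub
      (ha.2.dotProduct (hb.1.map₂ (isSmoothVec_const _) B))
      (hb.2.dotProduct (ha.1.map₂ (isSmoothVec_const _) B))⟩
  · exact ⟨isSmoothVec_const 0, fun k => IsSmoothFun.mul' contMDiff_const (ContMDiff.sub
      ((ha.genDeriv (F.smooth_field k)).dualPairing hb)
      (ha.dualPairing (hb.genDeriv (F.smooth_field k))))⟩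

end Courant

end GenGeom

end

/-! ### Involutivity of constant eigenbundles, and metrics with constant coefficients -/

noncomputable section

namespace GenGeom

open Matrix NilLie

section Involutive

variable {n : ℕ} {S : (Fin n → ℝ) × (Fin n → ℝ) →ₗ[ℝ] (Fin n → ℝ) × (Fin n → ℝ)}

theorem dualPairing_smul_left (c : ℝ) (a b : (Fin n → ℝ) × (Fin n → ℝ)) :
    dualPairing (c • a) b = c * dualPairing a b := by
  simp [dualPairing]
  ring

theorem dualPairing_smul_right (c : ℝ) (a b : (Fin n → ℝ) × (Fin n → ℝ)) :
    dualPairing a (c • b) = c * dualPairing a b := by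
  simp [dualPairing]
  ring

/-- The coefficients `(re, im)` of elements of the `ε i`-eigenspace. -/
def IsEigenPair (S : (Fin n → ℝ) × (Fin n → ℝ) →ₗ[ℝ] (Fin n → ℝ) × (Fin n → ℝ)) (ε : ℝ)
    (p q : (Fin n → ℝ) × (Fin n → ℝ)) : Prop :=
  S p = -(ε • q) ∧ S q = ε • p

/-- The eigenspaces are isotropic: the real part. -/
theorem IsEigenPair.dualPairing_eq (hskew : ∀ a b, dualPairing (S a) b = -dualPairing a (S b))
    {ε : ℝ} (hε : ε * ε = 1) {p q p' q' : (Fin n → ℝ) × (Fin n → ℝ)}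
    (h : IsEigenPair S ε p q) (h' : IsEigenPair S ε p' q') :
    dualPairing p p' = dualPairing q q' := by
  have h1 := hskew q p'
  rw [h.2, h'.1, ← neg_smul, dualPairing_smul_left, dualPairing_smul_right] at h1
  linear_combination ε * h1 - (dualPairing p p' - dualPairing q q') * hε

/-- The eigenspaces are isotropic: the imaginary part. -/
theorem IsEigenPair.dualPairing_eq_neg (hskew : ∀ a b, dualPairing (S a) b = -dualPairing a (S b))
    {ε : ℝ} (hε : ε * ε = 1) {p q p' q' : (Fin n → ℝ) × (Fin n → ℝ)}
    (h : IsEigenPair S ε p q) (h' : IsEigenPair S ε p' q') :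
    dualPairing p q' = -dualPairing q p' := by
  have h1 := hskew q q'
  rw [h.2, h'.2, dualPairing_smul_left, dualPairing_smul_right] at h1
  linear_combination ε * h1 - (dualPairing p q' + dualPairing q p') * hε

theorem IsEigenPair.eq_smul {ε : ℝ} (hε : ε * ε = 1) {p q : (Fin n → ℝ) × (Fin n → ℝ)}
    (h : IsEigenPair S ε p q) : q = (-ε) • S p := by
  rw [h.1, smul_neg, neg_smul, neg_neg, smul_smul, hε, one_smul]

variable {B : (Fin n → ℝ) →ₗ[ℝ] (Fin n → ℝ) →ₗ[ℝ] (Fin n → ℝ)}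

theorem courantAlg_smul (c d : ℝ) (a b : (Fin n → ℝ) × (Fin n → ℝ)) :
    courantAlg (fun v w => B v w) (c • a) (d • b) =
      (c * d) • courantAlg (fun v w => B v w) a b := by
  refine Prod.ext ?_ (funext fun k => ?_)
  · simp [courantAlg, smul_smul, mul_comm]
  · simp [courantAlg]
    ring

/-- If the Nijenhuis tensor of `S` vanishes, its eigenspaces are closed under the bracket. -/
theorem map_courantAlg_sub
    (hN : ∀ a b, S (courantAlg (fun v w => B v w) a b - courantAlg (fun v w => B v w) (S a) (S b)) =
      courantAlg (fun v w => B v w) a (S b) + courantAlg (fun v w => B v w) (S a) b)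
    {ε : ℝ} (hε : ε * ε = 1) {p q p' q' : (Fin n → ℝ) × (Fin n → ℝ)}
    (h : IsEigenPair S ε p q) (h' : IsEigenPair S ε p' q') :
    S (courantAlg (fun v w => B v w) p p' - courantAlg (fun v w => B v w) q q') =
      -(ε • (courantAlg (fun v w => B v w) p q' + courantAlg (fun v w => B v w) q p')) := by
  have h1 := courantAlg_smul (B := B) (-ε) (-ε) (S p) (S p')
  have h2 := courantAlg_smul (B := B) 1 (-ε) p (S p')
  have h3 := courantAlg_smul (B := B) (-ε) 1 (S p) p'
  rw [one_smul] at h2 h3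
  rw [neg_mul_neg, hε, one_smul] at h1
  rw [h.eq_smul hε, h'.eq_smul hε, h1, h2, h3, hN, one_mul, mul_one, ← smul_add, smul_smul,
    ← neg_smul, ← neg_mul, neg_mul_neg, hε, one_smul]

variable {M : Type*} [TopologicalSpace M] [ChartedSpace (EuclideanSpace ℝ (Fin n)) M]

/-- In the frame the eigenspace is a fixed subspace, so it contains the derivatives of functions
with values in it. -/
theorem IsEigenPair.genDeriv {ε : ℝ} {a b : M → (Fin n → ℝ) × (Fin n → ℝ)}
    (ha : IsSmoothGenVec a) (hb : IsSmoothGenVec b) (h : ∀ x, IsEigenPair S ε (a x) (b x))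
    (u : VField n M) (x : M) : IsEigenPair S ε (genDeriv u a x) (genDeriv u b x) := by
  constructor
  · rw [← genDeriv_map u ha, funext fun y => (h y).1, ← neg_smul, ← genDeriv_smul u hb]
    simp only [neg_smul]
  · rw [← genDeriv_map u hb, funext fun y => (h y).2, ← genDeriv_smul u ha]

end Involutive

section GeneralizedComplex

variable {n : ℕ} {M : Type*} [TopologicalSpace M] [ChartedSpace (EuclideanSpace ℝ (Fin n)) M]
  [IsManifold (𝓡 n) ∞ M] {B : (Fin n → ℝ) →ₗ[ℝ] (Fin n → ℝ) →ₗ[ℝ] (Fin n → ℝ)}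
  {S : (Fin n → ℝ) × (Fin n → ℝ) →ₗ[ℝ] (Fin n → ℝ) × (Fin n → ℝ)}

namespace InvFrame

variable (F : InvFrame n M B)

theorem isEigenSection_constGenEnd {ε : ℝ} {a b : M → (Fin n → ℝ) × (Fin n → ℝ)} :
    IsEigenSection (F.constGenEnd S) ε
      ⟨fun x => F.genEquiv x (a x), fun x => F.genEquiv x (b x)⟩ ↔
    IsSmoothGenVec a ∧ IsSmoothGenVec b ∧ ∀ x, IsEigenPair S ε (a x) (b x) := by
  simp only [IsEigenSection, isSmoothGenField_genEquiv, constGenEnd_genEquiv, ← map_smul,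
    ← map_neg, EmbeddingLike.apply_eq_iff_eq, IsEigenPair]

/-- The pairing corrections cancel: each pairs an eigensection with the derivative of another, both
in the same isotropic eigenspace. The imaginary part below is analogous. -/
theorem courantCoeff_re
    (hskew : ∀ a b, dualPairing (S a) b = -dualPairing a (S b)) {ε : ℝ} (hε : ε * ε = 1)
    {a a' b b' : M → (Fin n → ℝ) × (Fin n → ℝ)}
    (ha : IsSmoothGenVec a) (ha' : IsSmoothGenVec a') (hb : IsSmoothGenVec b)
    (hb' : IsSmoothGenVec b') (haa' : ∀ x, IsEigenPair S ε (a x) (a' x))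
    (hbb' : ∀ x, IsEigenPair S ε (b x) (b' x)) (x : M) :
    F.courantCoeff a b x - F.courantCoeff a' b' x =
      (courantAlg (fun v w => B v w) (a x) (b x) - courantAlg (fun v w => B v w) (a' x) (b' x))
      + ((genDeriv (F.ofCoeff fun y => (a y).1) b x - genDeriv (F.ofCoeff fun y => (b y).1) a x)
        - (genDeriv (F.ofCoeff fun y => (a' y).1) b' x
          - genDeriv (F.ofCoeff fun y => (b' y).1) a' x)) := by
  have hQ : ((0 : Fin n → ℝ), fun k => 1 / 2 * (dualPairing (genDeriv (F.field k) a x) (b x)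
        - dualPairing (a x) (genDeriv (F.field k) b x))) =
      (0, fun k => 1 / 2 * (dualPairing (genDeriv (F.field k) a' x) (b' x)
        - dualPairing (a' x) (genDeriv (F.field k) b' x))) := by
    refine Prod.ext rfl (funext fun k => ?_)
    dsimp only
    rw [(IsEigenPair.genDeriv ha ha' haa' (F.field k) x).dualPairing_eq hskew hε (hbb' x),
      (haa' x).dualPairing_eq hskew hε (IsEigenPair.genDeriv hb hb' hbb' (F.field k) x)]
  rw [courantCoeff, courantCoeff, hQ]
  abel

theorem courantCoeff_im
    (hskew : ∀ a b, dualPairing (S a) b = -dualPairing a (S b)) {ε : ℝ} (hε : ε * ε = 1)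
    {a a' b b' : M → (Fin n → ℝ) × (Fin n → ℝ)}
    (ha : IsSmoothGenVec a) (ha' : IsSmoothGenVec a') (hb : IsSmoothGenVec b)
    (hb' : IsSmoothGenVec b') (haa' : ∀ x, IsEigenPair S ε (a x) (a' x))
    (hbb' : ∀ x, IsEigenPair S ε (b x) (b' x)) (x : M) :
    F.courantCoeff a b' x + F.courantCoeff a' b x =
      (courantAlg (fun v w => B v w) (a x) (b' x) + courantAlg (fun v w => B v w) (a' x) (b x))
      + ((genDeriv (F.ofCoeff fun y => (a y).1) b' x - genDeriv (F.ofCoeff fun y => (b' y).1) a x)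
        + (genDeriv (F.ofCoeff fun y => (a' y).1) b x
          - genDeriv (F.ofCoeff fun y => (b y).1) a' x)) := by
  have hQ : ((0 : Fin n → ℝ), fun k => 1 / 2 * (dualPairing (genDeriv (F.field k) a x) (b' x)
        - dualPairing (a x) (genDeriv (F.field k) b' x))) =
      -(0, fun k => 1 / 2 * (dualPairing (genDeriv (F.field k) a' x) (b x)
        - dualPairing (a' x) (genDeriv (F.field k) b x))) := by
    refine Prod.ext (by simp) (funext fun k => ?_)
    simp only [Prod.snd_neg, Pi.neg_apply]
    rw [(IsEigenPair.genDeriv ha ha' haa' (F.field k) x).dualPairing_eq_neg hskew hε (hbb' x),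
      (haa' x).dualPairing_eq_neg hskew hε (IsEigenPair.genDeriv hb hb' hbb' (F.field k) x)]
    ring
  rw [courantCoeff, courantCoeff, hQ]
  abel

/-- Without the corrections, two kinds of terms remain: algebraic brackets, handled by
`map_courantAlg_sub`, and derivatives of eigensections along the real and imaginary anchor fields,
handled by `IsEigenPair.genDeriv`. -/
theorem isEigenPair_courantCoeff (hsq : ∀ a, S (S a) = -a)
    (hskew : ∀ a b, dualPairing (S a) b = -dualPairing a (S b))
    (hN : ∀ a b, S (courantAlg (fun v w => B v w) a b - courantAlg (fun v w => B v w) (S a) (S b)) =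
      courantAlg (fun v w => B v w) a (S b) + courantAlg (fun v w => B v w) (S a) b)
    {ε : ℝ} (hε : ε * ε = 1) {a a' b b' : M → (Fin n → ℝ) × (Fin n → ℝ)}
    (ha : IsSmoothGenVec a) (ha' : IsSmoothGenVec a') (hb : IsSmoothGenVec b)
    (hb' : IsSmoothGenVec b') (haa' : ∀ x, IsEigenPair S ε (a x) (a' x))
    (hbb' : ∀ x, IsEigenPair S ε (b x) (b' x)) (x : M) :
    IsEigenPair S ε (F.courantCoeff a b x - F.courantCoeff a' b' x)
      (F.courantCoeff a b' x + F.courantCoeff a' b x) := by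
  have h1 : S (F.courantCoeff a b x - F.courantCoeff a' b' x) =
      -(ε • (F.courantCoeff a b' x + F.courantCoeff a' b x)) := by
    rw [F.courantCoeff_re hskew hε ha ha' hb hb' haa' hbb',
      F.courantCoeff_im hskew hε ha ha' hb hb' haa' hbb', map_add,
      map_courantAlg_sub hN hε (haa' x) (hbb' x)]
    have hDa (u : VField n M) := IsEigenPair.genDeriv ha ha' haa' u x
    have hDb (u : VField n M) := IsEigenPair.genDeriv hb hb' hbb' u x
    simp only [map_sub, (hDa _).1, (hDa _).2, (hDb _).1, (hDb _).2]
    module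
  -- The second eigenvalue equation follows from the first by `S² = -1` and `ε² = 1`.
  refine ⟨h1, ?_⟩
  have h2 := hsq (F.courantCoeff a b x - F.courantCoeff a' b' x)
  rw [h1, map_neg, map_smul, neg_inj] at h2
  rw [← h2, smul_smul, hε, one_smul]

/-- Generalized complex structures with constant coefficients. -/
theorem isGeneralizedComplex_constGenEnd (hsq : ∀ a, S (S a) = -a)
    (hskew : ∀ a b, dualPairing (S a) b = -dualPairing a (S b))
    (hN : ∀ a b, S (courantAlg (fun v w => B v w) a b - courantAlg (fun v w => B v w) (S a) (S b)) =
      courantAlg (fun v w => B v w) a (S b) + courantAlg (fun v w => B v w) (S a) b) :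
    IsGeneralizedComplex (F.constGenEnd S) where
  smooth s hs := by
    obtain ⟨a, rfl⟩ := F.exists_eq_genEquiv s
    simp only [constGenEnd_genEquiv, isSmoothGenField_genEquiv] at hs ⊢
    exact hs.map S
  sq x s := by
    obtain ⟨a, rfl⟩ := (F.genEquiv x).surjective s
    rw [constGenEnd_genEquiv, constGenEnd_genEquiv, hsq, map_neg]
  skew x s t := by
    obtain ⟨a, rfl⟩ := (F.genEquiv x).surjective s
    obtain ⟨b, rfl⟩ := (F.genEquiv x).surjective t
    rw [constGenEnd_genEquiv, constGenEnd_genEquiv, pairing_genEquiv, pairing_genEquiv, hskew]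
  involutive ε hε s t hs ht := by
    obtain ⟨sr, si⟩ := s
    obtain ⟨tr, ti⟩ := t
    obtain ⟨a, rfl⟩ := F.exists_eq_genEquiv sr
    obtain ⟨a', rfl⟩ := F.exists_eq_genEquiv si
    obtain ⟨b, rfl⟩ := F.exists_eq_genEquiv tr
    obtain ⟨b', rfl⟩ := F.exists_eq_genEquiv ti
    obtain ⟨ha, ha', haa'⟩ := F.isEigenSection_constGenEnd.1 hs
    obtain ⟨hb, hb', hbb'⟩ := F.isEigenSection_constGenEnd.1 ht
    have hε' : ε * ε = 1 := by rcases hε with rfl | rfl <;> norm_num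
    refine ⟨⟨fun x => F.genEquiv x (F.courantCoeff a b x - F.courantCoeff a' b' x),
      fun x => F.genEquiv x (F.courantCoeff a b' x + F.courantCoeff a' b x)⟩, ?_, ?_⟩
    · exact ⟨_, _, _, _, F.isCourantBracket_courantCoeff ha hb,
        F.isCourantBracket_courantCoeff ha' hb', F.isCourantBracket_courantCoeff ha hb',
        F.isCourantBracket_courantCoeff ha' hb, fun x => map_sub _ _ _, fun x => map_add _ _ _⟩
    · exact F.isEigenSection_constGenEnd.2
        ⟨(ha.courantCoeff F hb).sub (ha'.courantCoeff F hb'),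
          (ha.courantCoeff F hb').add (ha'.courantCoeff F hb),
          F.isEigenPair_courantCoeff hsq hskew hN hε' ha ha' hb hb' haa' hbb'⟩

/-- The field of bilinear forms with constant coefficients. -/
def constForm (g : (Fin n → ℝ) →ₗ[ℝ] (Fin n → ℝ)) : FormField n M := fun x =>
  ((dotProductEquiv ℝ (Fin n)).toLinearMap ∘ₗ g).compl₁₂
    (F.toEquiv x).symm.toLinearMap (F.toEquiv x).symm.toLinearMap

theorem constForm_apply (g : (Fin n → ℝ) →ₗ[ℝ] (Fin n → ℝ)) (x : M)
    (u v : TangentSpace (𝓡 n) x) :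
    F.constForm g x u v = g ((F.toEquiv x).symm u) ⬝ᵥ (F.toEquiv x).symm v := rfl

theorem isPseudoRiemannian_constForm (g : (Fin n → ℝ) ≃ₗ[ℝ] (Fin n → ℝ))
    (hg : ∀ u v, g u ⬝ᵥ v = g v ⬝ᵥ u) : IsPseudoRiemannian (F.constForm g.toLinearMap) where
  smooth u v hu hv := ((F.isSmoothVec_coeff hu).map g.toLinearMap).dotProduct
    (F.isSmoothVec_coeff hv)
  symm x u v := hg _ _
  nondegenerate x := by
    have hleft (u : TangentSpace (𝓡 n) x) (hu : ∀ v, F.constForm g.toLinearMap x u v = 0) :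
        u = 0 := by
      have h : g ((F.toEquiv x).symm u) = 0 := dotProduct_eq_zero _ fun w => by
        simpa [constForm_apply] using hu (F.toEquiv x w)
      simpa using h
    exact ⟨hleft, fun u hu => hleft u fun v => (hg _ _).trans (hu v)⟩

theorem metricEnd_genEquiv (g : (Fin n → ℝ) ≃ₗ[ℝ] (Fin n → ℝ))
    (hg : IsPseudoRiemannian (F.constForm g.toLinearMap)) (k : ℝ) (x : M)
    (a : (Fin n → ℝ) × (Fin n → ℝ)) :
    metricEnd hg k x (F.genEquiv x a) = F.genEquiv x (k • g.symm a.2, g a.1) := by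
  refine Prod.ext ?_ ?_
  · change k • _ = F.toEquiv x (k • g.symm a.2)
    rw [map_smul]
    congr 1
    change ((F.constForm g.toLinearMap x).toDual (hg.nondegenerate x)).symm _ = _
    rw [LinearEquiv.symm_apply_eq]
    ext w
    rw [LinearMap.BilinForm.toDual_def, constForm_apply, LinearMap.snd_apply, genEquiv_snd]
    simp
  · ext w
    change (F.constForm g.toLinearMap x).toDual (hg.nondegenerate x) _ w = _
    rw [LinearMap.BilinForm.toDual_def, constForm_apply, genEquiv_snd,
      LinearMap.fst_apply, genEquiv_fst]
    simp

/-- Integrable `(-1,-1)`-structures with constant coefficients. -/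
theorem isIntegrableNegStructure_constGenEnd (g : (Fin n → ℝ) ≃ₗ[ℝ] (Fin n → ℝ))
    (hg : IsPseudoRiemannian (F.constForm g.toLinearMap))
    (hS : IsGeneralizedComplex (F.constGenEnd S))
    (hgS : ∀ a, S (-g.symm a.2, g a.1) = -(-g.symm (S a).2, g (S a).1)) :
    IsIntegrableNegStructure hg (-1) (F.constGenEnd S) := by
  refine ⟨hS, fun x s => ?_⟩
  obtain ⟨a, rfl⟩ := (F.genEquiv x).surjective s
  rw [constGenEnd_genEquiv, metricEnd_genEquiv, metricEnd_genEquiv, constGenEnd_genEquiv,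
    ← map_neg]
  congr 1
  simpa using hgS a

end InvFrame

end GeneralizedComplex

end GenGeom

end

/-! ### Maps compatible with frames, and smoothness of left invariant vector fields -/

noncomputable section

namespace GenGeom

open Matrix NilLie

section Related

variable {n : ℕ} {N M : Type*}
  [TopologicalSpace M] [ChartedSpace (EuclideanSpace ℝ (Fin n)) M] [IsManifold (𝓡 n) ∞ M]
  [TopologicalSpace N] [ChartedSpace (EuclideanSpace ℝ (Fin n)) N] [IsManifold (𝓡 n) ∞ N]
  {B : (Fin n → ℝ) →ₗ[ℝ] (Fin n → ℝ) →ₗ[ℝ] (Fin n → ℝ)}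

/-- The differential of `f` takes the frame `F` to the frame `F'`. -/
def FrameRelated (f : N → M) (F : InvFrame n N B) (F' : InvFrame n M B) : Prop :=
  ∀ x v, mfderiv (𝓡 n) (𝓡 n) f x (F.toEquiv x v) = F'.toEquiv (f x) v

variable {f : N → M} {F : InvFrame n N B} {F' : InvFrame n M B}

theorem FrameRelated.symm_mfderiv (h : FrameRelated f F F') (x : N) (u : TangentSpace (𝓡 n) x) :
    (F'.toEquiv (f x)).symm (mfderiv (𝓡 n) (𝓡 n) f x u) = (F.toEquiv x).symm u := by
  rw [LinearEquiv.symm_apply_eq, ← h, LinearEquiv.apply_symm_apply]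

theorem FrameRelated.formRelated (h : FrameRelated f F F')
    (g : (Fin n → ℝ) →ₗ[ℝ] (Fin n → ℝ)) :
    FormRelated f (F.constForm g) (F'.constForm g) := by
  intro x u v
  rw [InvFrame.constForm_apply, InvFrame.constForm_apply, h.symm_mfderiv, h.symm_mfderiv]

/-- In related frames, both pushing vectors forward and pulling covectors back are the identity on
coefficients, so constant endomorphisms correspond automatically. -/
theorem FrameRelated.genRelated_iff (h : FrameRelated f F F') (x : N)
    (a b : (Fin n → ℝ) × (Fin n → ℝ)) :
    GenRelated f x (F.genEquiv x a) (F'.genEquiv (f x) b) ↔ a = b := by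
  constructor
  · rintro ⟨h1, h2⟩
    refine Prod.ext ?_ ?_
    · rw [InvFrame.genEquiv_fst, InvFrame.genEquiv_fst, h] at h1
      exact (F'.toEquiv (f x)).injective h1
    · refine dotProduct_eq _ _ fun w => ?_
      have h3 := h2 (F.toEquiv x w)
      rwa [InvFrame.genEquiv_snd, InvFrame.genEquiv_snd, h.symm_mfderiv,
        LinearEquiv.symm_apply_apply] at h3
  · rintro rfl
    refine ⟨?_, fun v => ?_⟩
    · rw [InvFrame.genEquiv_fst, InvFrame.genEquiv_fst, h]
    · rw [InvFrame.genEquiv_snd, InvFrame.genEquiv_snd, h.symm_mfderiv]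

theorem FrameRelated.genEndRelated (h : FrameRelated f F F')
    (S : (Fin n → ℝ) × (Fin n → ℝ) →ₗ[ℝ] (Fin n → ℝ) × (Fin n → ℝ)) :
    GenEndRelated f (F.constGenEnd S) (F'.constGenEnd S) := by
  intro x s t hst
  obtain ⟨a, rfl⟩ := (F.genEquiv x).surjective s
  obtain ⟨b, rfl⟩ := (F'.genEquiv (f x)).surjective t
  rw [h.genRelated_iff] at hst
  rw [InvFrame.constGenEnd_genEquiv, InvFrame.constGenEnd_genEquiv, h.genRelated_iff, hst]

end Related

/-! ### Left invariant frames -/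

section Group

variable {n : ℕ} {G : Type*} [TopologicalSpace G] [ChartedSpace (EuclideanSpace ℝ (Fin n)) G]
  [Group G] [LieGroup (𝓡 n) ∞ G]

theorem mdifferentiableAt_mul_left' (h x : G) :
    MDifferentiableAt (𝓡 n) (𝓡 n) (fun y => h * y) x :=
  (contMDiff_mul_left (I := 𝓡 n) (n := ∞) (a := h)).mdifferentiable (by simp) x

/-- The chain rule at the identity for `L_{hx} = L_h ∘ L_x`. -/
theorem mfderiv_mul_left_mulInvariantVectorField (h x : G) (v : GroupLieAlgebra (𝓡 n) G) :
    mfderiv (𝓡 n) (𝓡 n) (fun y => h * y) x (mulInvariantVectorField v x) =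
      mulInvariantVectorField v (h * x) := by
  have D : (fun y => h * x * y) = (fun y => h * y) ∘ (fun y => x * y) := by
    funext y
    simp [mul_assoc]
  have h1 : mfderiv (𝓡 n) (𝓡 n) (fun y => h * x * y) 1 =
      (mfderiv (𝓡 n) (𝓡 n) (fun y => h * y) (x * 1)).comp
        (mfderiv (𝓡 n) (𝓡 n) (fun y => x * y) 1) := by
    rw [D, mfderiv_comp (I' := 𝓡 n) _ (mdifferentiableAt_mul_left' _ _)
      (mdifferentiableAt_mul_left' _ _)]
  -- The chain rule lands at `x * 1`; moving to `x` is harmless because all tangent spaces are the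
  -- same model space.
  have h2 (z : G) (hz : z = x) (u : EuclideanSpace ℝ (Fin n)) :
      (mfderiv (𝓡 n) (𝓡 n) (fun y => h * y) z u : EuclideanSpace ℝ (Fin n)) =
        mfderiv (𝓡 n) (𝓡 n) (fun y => h * y) x u := by
    subst hz
    rfl
  exact (h2 (x * 1) (mul_one x) _).symm.trans (congrArg (fun L => L v) h1).symm

/-- The value at `g` is the tangent map of multiplication applied to the zero vector at `g` and `v`
at the identity, a composite of smooth maps. -/
theorem isSmoothVField_mulInvariantVectorField (v : GroupLieAlgebra (𝓡 n) G) :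
    IsSmoothVField (n := n) (M := G) (mulInvariantVectorField v) := by
  let fg : G → TangentBundle (𝓡 n) G :=
    fun g => Bundle.TotalSpace.mk' (EuclideanSpace ℝ (Fin n)) g 0
  have sfg : ContMDiff (𝓡 n) (𝓡 n).tangent ∞ fg := Bundle.contMDiff_zeroSection _ _
  let fv : G → TangentBundle (𝓡 n) G :=
    fun _ => Bundle.TotalSpace.mk' (EuclideanSpace ℝ (Fin n)) 1 v
  have sfv : ContMDiff (𝓡 n) (𝓡 n).tangent ∞ fv := contMDiff_const
  have s₂ : ContMDiff ((𝓡 n).tangent.prod (𝓡 n).tangent) ((𝓡 n).prod (𝓡 n)).tangent ∞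
      (equivTangentBundleProd (𝓡 n) G (𝓡 n) G).symm := contMDiff_equivTangentBundleProd_symm
  have s₃ : ContMDiff ((𝓡 n).prod (𝓡 n)).tangent (𝓡 n).tangent ∞
      (tangentMap ((𝓡 n).prod (𝓡 n)) (𝓡 n) (fun p : G × G => p.1 * p.2)) :=
    ContMDiff.contMDiff_tangentMap (contMDiff_mul (𝓡 n) ∞) (by simp)
  refine ((s₃.comp s₂).comp (sfg.prodMk sfv)).congr fun g => ?_
  have hd : MDifferentiableAt ((𝓡 n).prod (𝓡 n)) (𝓡 n) (fun p : G × G => p.1 * p.2) (g, 1) :=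
    (contMDiff_mul (𝓡 n) ∞).mdifferentiable (by simp) _
  have hext (z : G) (hz : g = z) (a b : EuclideanSpace ℝ (Fin n)) (hab : a = b) :
      (Bundle.TotalSpace.mk g a : TangentBundle (𝓡 n) G) = Bundle.TotalSpace.mk z b := by
    subst hz hab
    rfl
  have h1 := mfderiv_prod_eq_add_apply (v := (((0 : EuclideanSpace ℝ (Fin n)),
    (v : EuclideanSpace ℝ (Fin n))) : TangentSpace ((𝓡 n).prod (𝓡 n)) ((g, 1) : G × G))) hd
  refine hext (g * 1) (mul_one g).symm _ _ (Eq.trans ?_ h1.symm)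
  have h0 := (mfderiv (𝓡 n) (𝓡 n) (fun z : G => z * 1) g).map_zero
  refine Eq.trans (zero_add _).symm (congrArg₂ (· + ·) h0.symm rfl)

end Group

end GenGeom

end

/-! ### The left invariant frame and its descent to the quotient -/

noncomputable section

namespace GenGeom

open Matrix NilLie

section Group

variable {n : ℕ} {G : Type*} [TopologicalSpace G] [ChartedSpace (EuclideanSpace ℝ (Fin n)) G]
  [Group G] {B : (Fin n → ℝ) →ₗ[ℝ] (Fin n → ℝ) →ₗ[ℝ] (Fin n → ℝ)}

theorem mulInvariantVectorField_one (v : GroupLieAlgebra (𝓡 n) G) :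
    mulInvariantVectorField v 1 = v := by
  have h : (fun y : G => 1 * y) = id := funext one_mul
  have h1 : mfderiv (𝓡 n) (𝓡 n) (fun y : G => 1 * y) 1 =
      (ContinuousLinearMap.id ℝ (TangentSpace (𝓡 n) (1 : G)) :) := by
    rw [h]
    exact mfderiv_id
  exact congrArg (fun L => L v) h1

variable [LieGroup (𝓡 n) ∞ G]

theorem mlieBracket_mulInvariantVectorField (v w : GroupLieAlgebra (𝓡 n) G) :
    VectorField.mlieBracket (𝓡 n) (mulInvariantVectorField v) (mulInvariantVectorField w) =
      mulInvariantVectorField (G := G) (I := 𝓡 n) ⁅v, w⁆ := by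
  rw [GroupLieAlgebra.bracket_def, mulInvariantVector_mlieBracket]

/-- Left translation by `x⁻¹` recovers `v` at the identity. -/
theorem mulInvariantVectorField_injective (x : G) :
    Function.Injective (fun v : GroupLieAlgebra (𝓡 n) G => mulInvariantVectorField v x) := by
  intro v w hvw
  have h := congrArg (mfderiv (𝓡 n) (𝓡 n) (fun y => x⁻¹ * y) x) hvw
  simp only [mfderiv_mul_left_mulInvariantVectorField] at h
  have h2 (z : G) (hz : z = 1) (h : mulInvariantVectorField (I := 𝓡 n) v z =
      mulInvariantVectorField w z) : v = w := by
    subst hz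
    rwa [mulInvariantVectorField_one, mulInvariantVectorField_one] at h
  exact h2 _ (inv_mul_cancel x) h

/-- The value of left invariant vector fields at `x`, as a linear isomorphism. -/
def leftTransEquiv (x : G) : GroupLieAlgebra (𝓡 n) G ≃ₗ[ℝ] TangentSpace (𝓡 n) x :=
  LinearMap.linearEquivOfInjective
    { toFun := fun v => mulInvariantVectorField v x
      map_add' := fun v w => congrFun (mulInvariantVectorField_add v w) x
      map_smul' := fun c v => congrFun (mulInvariantVectorField_smul c v) x }
    (mulInvariantVectorField_injective x) rfl

/-- The frame of left invariant vector fields. -/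
def groupFrame (φ : GroupLieAlgebra (𝓡 n) G ≃ₗ[ℝ] (Fin n → ℝ))
    (hφ : ∀ v w, φ ⁅v, w⁆ = B (φ v) (φ w)) : InvFrame n G B where
  toEquiv x := φ.symm.trans (leftTransEquiv x)
  smooth v := isSmoothVField_mulInvariantVectorField (φ.symm v)
  bracket_eq v w x := by
    refine (congrFun (mlieBracket_mulInvariantVectorField (φ.symm v) (φ.symm w)) x).trans ?_
    change leftTransEquiv x _ = leftTransEquiv x (φ.symm (B v w))
    congr 1
    rw [LinearEquiv.eq_symm_apply, hφ, LinearEquiv.apply_symm_apply, LinearEquiv.apply_symm_apply]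

theorem groupFrame_mul_left (φ : GroupLieAlgebra (𝓡 n) G ≃ₗ[ℝ] (Fin n → ℝ))
    (hφ : ∀ v w, φ ⁅v, w⁆ = B (φ v) (φ w)) (h : G) :
    FrameRelated (fun x => h * x) (groupFrame φ hφ) (groupFrame φ hφ) :=
  fun x v => mfderiv_mul_left_mulInvariantVectorField h x (φ.symm v)

end Group

section Quotient

variable {n : ℕ} {G : Type*} [TopologicalSpace G] [ChartedSpace (EuclideanSpace ℝ (Fin n)) G]
  [Group G] [LieGroup (𝓡 n) ∞ G] {B : (Fin n → ℝ) →ₗ[ℝ] (Fin n → ℝ) →ₗ[ℝ] (Fin n → ℝ)}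
  {M : Type*} [TopologicalSpace M] [ChartedSpace (EuclideanSpace ℝ (Fin n)) M]
  {Γ : Subgroup G} {π : G → M}

/-- The frame of a manifold at the image of a point `x` of the group. -/
def quotientEquivAt (F : InvFrame n G B) (hπ : IsLocalDiffeomorph (𝓡 n) (𝓡 n) ∞ π) (x : G) :
    (Fin n → ℝ) ≃ₗ[ℝ] EuclideanSpace ℝ (Fin n) :=
  (F.toEquiv x).trans (hπ.mfderivToContinuousLinearEquiv (by simp) x).toLinearEquiv

theorem quotientEquivAt_apply (F : InvFrame n G B)
    (hπ : IsLocalDiffeomorph (𝓡 n) (𝓡 n) ∞ π) (x : G) (v : Fin n → ℝ) :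
    quotientEquivAt F hπ x v = mfderiv (𝓡 n) (𝓡 n) π x (F.toEquiv x v) :=
  rfl

/-- Two points of a fibre differ by some `γ ∈ Γ`. Differentiating `π = π ∘ L_γ` and using invariance
of the frame shows that the choice of preimage does not matter. -/
theorem quotientEquivAt_eq (F : InvFrame n G B) (hF : ∀ h : G, FrameRelated (fun x => h * x) F F)
    (hπ : IsLeftQuotient n Γ π) {x y : G} (hxy : π x = π y) (v : Fin n → ℝ) :
    quotientEquivAt F hπ.localDiffeo x v = quotientEquivAt F hπ.localDiffeo y v := by
  obtain ⟨γ, hγ, rfl⟩ := (hπ.fiber x y).1 hxy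
  have hcomp : π = π ∘ (fun z => γ * z) := funext fun z => (hπ.fiber z (γ * z)).2 ⟨γ, hγ, rfl⟩
  have hd (z : G) : MDifferentiableAt (𝓡 n) (𝓡 n) π z :=
    hπ.localDiffeo.mdifferentiable (by simp) z
  have h1 := mfderiv_comp x (hd (γ * x)) (mdifferentiableAt_mul_left' (n := n) γ x)
  rw [← hcomp] at h1
  rw [quotientEquivAt_apply, quotientEquivAt_apply, ← hF γ x v]
  exact congrArg (fun L => L (F.toEquiv x v)) h1

/-- The frame induced on a quotient. -/
def quotientEquiv (F : InvFrame n G B) (hπ : IsLeftQuotient n Γ π) (p : M) :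
    (Fin n → ℝ) ≃ₗ[ℝ] TangentSpace (𝓡 n) p :=
  quotientEquivAt F hπ.localDiffeo (Function.surjInv hπ.surjective p)

theorem mfderiv_toEquiv (F : InvFrame n G B) (hF : ∀ h : G, FrameRelated (fun x => h * x) F F)
    (hπ : IsLeftQuotient n Γ π) (x : G) (v : Fin n → ℝ) :
    mfderiv (𝓡 n) (𝓡 n) π x (F.toEquiv x v) = quotientEquiv F hπ (π x) v :=
  (quotientEquivAt_apply F hπ.localDiffeo x v).symm.trans
    (quotientEquivAt_eq F hF hπ (Function.surjInv_eq hπ.surjective (π x)).symm v)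

variable [IsManifold (𝓡 n) ∞ M]

/-- Near `π x` the field is the tangent map of `π` composed with the frame field and a smooth local
inverse of `π`. -/
theorem isSmoothVField_quotientEquiv (F : InvFrame n G B)
    (hF : ∀ h : G, FrameRelated (fun x => h * x) F F)
    (hπ : IsLeftQuotient n Γ π) (v : Fin n → ℝ) :
    IsSmoothVField (fun p => quotientEquiv F hπ p v) := by
  intro p
  obtain ⟨x, rfl⟩ := hπ.surjective p
  have hx := hπ.localDiffeo x
  let q := hx.localInverse
  have hq : ContMDiffAt (𝓡 n) (𝓡 n) ∞ q (π x) := hx.localInverse_contMDiffAt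
  have ht : ContMDiff (𝓡 n).tangent (𝓡 n).tangent ∞ (tangentMap (𝓡 n) (𝓡 n) π) :=
    ContMDiff.contMDiff_tangentMap hπ.localDiffeo.contMDiff (by simp)
  have h := ((ht.comp (F.smooth v)).contMDiffAt (x := q (π x))).comp (π x) hq
  refine h.congr_of_eventuallyEq ?_
  filter_upwards [hx.localInverse_eventuallyEq_right] with p' hp'
  have key (y : G) : (⟨π y, quotientEquiv F hπ (π y) v⟩ : TangentBundle (𝓡 n) M) =
      tangentMap (𝓡 n) (𝓡 n) π ⟨y, F.toEquiv y v⟩ :=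
    congrArg (Bundle.TotalSpace.mk (π y)) (mfderiv_toEquiv F hF hπ y v).symm
  refine Eq.trans ?_ (key (q p'))
  exact congrArg (fun z => (⟨z, quotientEquiv F hπ z v⟩ : TangentBundle (𝓡 n) M)) hp'.symm

/-- Pullback along the local diffeomorphism `π` commutes with Lie brackets and takes the quotient
frame to `F`. -/
theorem bracket_quotientEquiv (F : InvFrame n G B)
    (hF : ∀ h : G, FrameRelated (fun x => h * x) F F)
    (hπ : IsLeftQuotient n Γ π) (v w : Fin n → ℝ) (p : M) :
    bracket (fun p => quotientEquiv F hπ p v) (fun p => quotientEquiv F hπ p w) p =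
      quotientEquiv F hπ p (B v w) := by
  obtain ⟨x, rfl⟩ := hπ.surjective p
  have hinv (y : G) (u : TangentSpace (𝓡 n) y) :
      (mfderiv (𝓡 n) (𝓡 n) π y).inverse (mfderiv (𝓡 n) (𝓡 n) π y u) = u := by
    rw [← hπ.localDiffeo.mfderivToContinuousLinearEquiv_coe (by simp) y,
      ContinuousLinearMap.inverse_equiv]
    exact ContinuousLinearEquiv.symm_apply_apply _ _
  have hpull (v : Fin n → ℝ) :
      VectorField.mpullback (𝓡 n) (𝓡 n) π (fun p => quotientEquiv F hπ p v) =
        fun y => F.toEquiv y v := by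
    funext y
    rw [VectorField.mpullback_apply, ← mfderiv_toEquiv F hF hπ, hinv]
  have h := VectorField.mpullback_mlieBracket (n := ∞) (I := 𝓡 n) (I' := 𝓡 n) (f := π) (x₀ := x)
    ((isSmoothVField_quotientEquiv F hF hπ v).mdiffAt (π x))
    ((isSmoothVField_quotientEquiv F hF hπ w).mdiffAt (π x))
    hπ.localDiffeo.contMDiff.contMDiffAt (by
      rw [minSmoothness_of_isRCLikeNormedField]; exact ENat.LEInfty.out)
  rw [hpull, hpull] at h
  have h2 := h.trans (F.bracket_eq v w x)
  rw [VectorField.mpullback_apply, ← hinv x (F.toEquiv x (B v w)), mfderiv_toEquiv F hF hπ] at h2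
  have hinj : Function.Injective (mfderiv (𝓡 n) (𝓡 n) π x).inverse := by
    rw [← hπ.localDiffeo.mfderivToContinuousLinearEquiv_coe (by simp) x,
      ContinuousLinearMap.inverse_equiv]
    exact ContinuousLinearEquiv.injective _
  exact hinj h2

/-- The frame induced on a quotient by the left invariant vector fields. -/
def quotientFrame (F : InvFrame n G B) (hF : ∀ h : G, FrameRelated (fun x => h * x) F F)
    (hπ : IsLeftQuotient n Γ π) : InvFrame n M B where
  toEquiv := quotientEquiv F hπ
  smooth := isSmoothVField_quotientEquiv F hF hπ
  bracket_eq := bracket_quotientEquiv F hF hπ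

theorem frameRelated_quotientFrame (F : InvFrame n G B)
    (hF : ∀ h : G, FrameRelated (fun x => h * x) F F) (hπ : IsLeftQuotient n Γ π) :
    FrameRelated π F (quotientFrame F hF hπ) :=
  mfderiv_toEquiv F hF hπ

end Quotient

end GenGeom

end

noncomputable section

namespace GenGeom

open Matrix NilLie

/-! ### Invariant tensor fields have constant coefficients -/

section Invariant

variable {n : ℕ} {G : Type*} [TopologicalSpace G] [ChartedSpace (EuclideanSpace ℝ (Fin n)) G]
  [Group G] [LieGroup (𝓡 n) ∞ G] {B : (Fin n → ℝ) →ₗ[ℝ] (Fin n → ℝ) →ₗ[ℝ] (Fin n → ℝ)}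
  {M : Type*} [TopologicalSpace M] [ChartedSpace (EuclideanSpace ℝ (Fin n)) M]
  [IsManifold (𝓡 n) ∞ M] {π : G → M} {F : InvFrame n G B} {F' : InvFrame n M B}

/-- The coefficients are read off at the identity, carried over `G` by left translations, and then
to `M` by `π`. -/
theorem exists_endCoeff (hF : ∀ h : G, FrameRelated (fun x => h * x) F F)
    (hπ : Function.Surjective π) (hFF' : FrameRelated π F F') {J : EndField n M}
    (hJ : IsLeftInvariantEnd π J) :
    ∃ J₀ : (Fin n → ℝ) →ₗ[ℝ] (Fin n → ℝ), ∀ p v, J p (F'.toEquiv p v) = F'.toEquiv p (J₀ v) := by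
  obtain ⟨J', hJ', hJJ'⟩ := hJ
  let J₀ : (Fin n → ℝ) →ₗ[ℝ] (Fin n → ℝ) :=
    (F.toEquiv 1).symm.toLinearMap ∘ₗ J' 1 ∘ₗ (F.toEquiv 1).toLinearMap
  have h1 (v : Fin n → ℝ) : F.toEquiv 1 (J₀ v) = J' 1 (F.toEquiv 1 v) := by simp [J₀]
  have h2 (x : G) (v : Fin n → ℝ) : J' x (F.toEquiv x v) = F.toEquiv x (J₀ v) := by
    have h : J' (x * 1) (F.toEquiv (x * 1) v) = F.toEquiv (x * 1) (J₀ v) := by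
      have := hJ' x 1 (F.toEquiv 1 v)
      rw [← h1, hF, hF] at this
      exact this.symm
    exact mul_one x ▸ h
  refine ⟨J₀, fun p v => ?_⟩
  obtain ⟨x, rfl⟩ := hπ p
  rw [← hFF' x v, ← hJJ', h2, hFF']

theorem exists_formCoeff (hF : ∀ h : G, FrameRelated (fun x => h * x) F F)
    (hπ : Function.Surjective π) (hFF' : FrameRelated π F F') {Ω : FormField n M}
    (hΩ : IsLeftInvariantForm π Ω) :
    ∃ Ω₀ : LinearMap.BilinForm ℝ (Fin n → ℝ),
      ∀ p v w, Ω p (F'.toEquiv p v) (F'.toEquiv p w) = Ω₀ v w := by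
  obtain ⟨Ω', hΩ', hΩΩ'⟩ := hΩ
  refine ⟨(Ω' 1).compl₁₂ (F.toEquiv 1).toLinearMap (F.toEquiv 1).toLinearMap, fun p v w => ?_⟩
  obtain ⟨x, rfl⟩ := hπ p
  have h2 : Ω' x (F.toEquiv x v) (F.toEquiv x w) = Ω' 1 (F.toEquiv 1 v) (F.toEquiv 1 w) := by
    have h := hΩ' x 1 (F.toEquiv 1 v) (F.toEquiv 1 w)
    rw [hF, hF] at h
    have h' : Ω' 1 (F.toEquiv 1 v) (F.toEquiv 1 w) =
      Ω' (x * 1) (F.toEquiv (x * 1) v) (F.toEquiv (x * 1) w) := h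
    rw [h', mul_one]
  rw [← hFF' x v, ← hFF' x w, ← hΩΩ', h2]
  rfl

/-- Since `J` takes frame fields to frame fields, only brackets with constant coefficients occur. -/
theorem nijenhuis_coeff {J : EndField n M} (hJ : IsComplexStructure J) [Nonempty M]
    {J₀ : (Fin n → ℝ) →ₗ[ℝ] (Fin n → ℝ)}
    (h : ∀ p v, J p (F'.toEquiv p v) = F'.toEquiv p (J₀ v)) :
    (∀ u, J₀ (J₀ u) = -u) ∧
      ∀ u v, B (J₀ u) (J₀ v) - J₀ (B (J₀ u) v) - J₀ (B u (J₀ v)) - B u v = 0 := by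
  obtain ⟨p⟩ := ‹Nonempty M›
  constructor
  · intro u
    have h1 := hJ.sq p (F'.toEquiv p u)
    rw [h, h, ← map_neg] at h1
    exact (F'.toEquiv p).injective h1
  · intro u v
    have h1 := hJ.nijenhuis _ _ (F'.smooth u) (F'.smooth v) p
    simp only [h, F'.bracket_eq, ← map_sub] at h1
    exact (F'.toEquiv p).map_eq_zero_iff.1 h1

/-- On frame fields `Ω` is constant, so the derivative terms of `dΩ` vanish and the algebraic ones
remain. -/
theorem closed_coeff {Ω : FormField n M} (hΩ : IsSymplectic Ω) [Nonempty M]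
    {Ω₀ : LinearMap.BilinForm ℝ (Fin n → ℝ)}
    (h : ∀ p v w, Ω p (F'.toEquiv p v) (F'.toEquiv p w) = Ω₀ v w) :
    Ω₀.IsAlt ∧ (∀ u, Ω₀ u = 0 → u = 0) ∧
      ∀ u v w, Ω₀ (B u v) w - Ω₀ (B u w) v + Ω₀ (B v w) u = 0 := by
  obtain ⟨p⟩ := ‹Nonempty M›
  refine ⟨fun u => ?_, fun u hu => ?_, fun u v w => ?_⟩
  · rw [← h p]
    exact hΩ.alt p _
  · have h1 := (hΩ.nondegenerate p).1 (F'.toEquiv p u) fun w => by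
      obtain ⟨w, rfl⟩ := (F'.toEquiv p).surjective w
      rw [h, hu]
      rfl
    simpa using h1
  · have h1 := hΩ.closed _ _ _ (F'.smooth u) (F'.smooth v) (F'.smooth w) p
    simp only [h, F'.bracket_eq, dirDeriv_const] at h1
    linarith

end Invariant

end GenGeom

/-! ### Conclusion -/

namespace NilLie

/-- The bracket of the Lie algebras as a bilinear map. -/
def nilBracketHom (i : Fin 5) : (Fin 6 → ℝ) →ₗ[ℝ] (Fin 6 → ℝ) →ₗ[ℝ] (Fin 6 → ℝ) :=
  LinearMap.mk₂ ℝ (nilBracket i) (nilBracket_add_left i)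
    (fun c x y => by
      funext k
      fin_cases i <;> fin_cases k <;> simp [nilBracket, wedge] <;> ring)
    (nilBracket_add_right i) (nilBracket_smul i)

end NilLie

end

open NilLie GenGeom in
theorem mainTheorem4 (i : Fin 5)
    {G : Type*} [TopologicalSpace G] [ChartedSpace (EuclideanSpace ℝ (Fin 6)) G] [Group G]
    [LieGroup (𝓡 6) ∞ G] (φ : GroupLieAlgebra (𝓡 6) G ≃ₗ⁅ℝ⁆ NilAlg i)
    {M : Type*} [TopologicalSpace M] [T2Space M] [ChartedSpace (EuclideanSpace ℝ (Fin 6)) M]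
    [IsManifold (𝓡 6) ∞ M] (Γ : Subgroup G) (π : G → M) (hπ : IsLeftQuotient 6 Γ π) :
    (¬ ∃ J : EndField 6 M, IsComplexStructure J ∧ IsLeftInvariantEnd π J) ∧
    (¬ ∃ Ω : FormField 6 M, IsSymplectic Ω ∧ IsLeftInvariantForm π Ω) ∧
    ∃ (g : FormField 6 M) (hg : IsPseudoRiemannian g) (S : GenEndField 6 M),
      IsLeftInvariantForm π g ∧ IsLeftInvariantGenEnd π S ∧
      IsIntegrableNegStructure hg (-1) S := by
  let ψ : GroupLieAlgebra (𝓡 6) G ≃ₗ[ℝ] (Fin 6 → ℝ) := φ.toLinearEquiv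
  let F : InvFrame 6 G (nilBracketHom i) := groupFrame ψ fun v w => φ.map_lie v w
  have hF (h : G) : FrameRelated (fun x => h * x) F F := groupFrame_mul_left ψ _ h
  let F' : InvFrame 6 M (nilBracketHom i) := quotientFrame F hF hπ
  have hFF' : FrameRelated π F F' := frameRelated_quotientFrame F hF hπ
  have : Nonempty M := ⟨π 1⟩
  refine ⟨?_, ?_, ?_⟩
  · rintro ⟨J, hJ, hJinv⟩
    obtain ⟨J₀, hJ₀⟩ := exists_endCoeff hF hπ.surjective hFF' hJinv
    obtain ⟨hsq, hN⟩ := nijenhuis_coeff hJ hJ₀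
    exact not_complex i hsq hN
  · rintro ⟨Ω, hΩ, hΩinv⟩
    obtain ⟨Ω₀, hΩ₀⟩ := exists_formCoeff hF hπ.surjective hFF' hΩinv
    obtain ⟨halt, hnd, hcl⟩ := closed_coeff hΩ hΩ₀
    -- Nondegeneracy would force `e₅ = 0`; its last coordinate reads `1 = 0`.
    have h := congrFun (hnd _ (closed_form_stdVec_five i Ω₀ halt hcl)) 5
    simp at h
  · refine ⟨F'.constForm (metric i).toLinearMap,
      F'.isPseudoRiemannian_constForm (metric i) (metric_symm i), F'.constGenEnd (genStruct i),
      ⟨F.constForm (metric i).toLinearMap, fun h => (hF h).formRelated _, hFF'.formRelated _⟩,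
      ⟨F.constGenEnd (genStruct i), fun h => (hF h).genEndRelated _, hFF'.genEndRelated _⟩, ?_⟩
    exact F'.isIntegrableNegStructure_constGenEnd (metric i) _
      (F'.isGeneralizedComplex_constGenEnd (genStruct_sq i) (genStruct_skew i)
        (genStruct_nijenhuis i)) (genStruct_metric i)
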